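/- Let $\mathcal C$ be a weakly abelian category, that is, an additive category in which every morphism has a weak kernel and a weak cokernel, and in which every morphism is a weak kernel and a weak cokernel. Let $n\ge 0$. Let $\hat{\mathcal C}$ be the Freyd category of $\mathcal C$: the category of morphisms of $\mathcal C$ modulo its full subcategory of zero morphisms. Identify $\mathcal C$ with a full subcategory of $\hat{\mathcal C}$ via $X\mapsto 1_X$. (For a full additive subcategory $\mathcal N$ of an additive category $\mathcal A$, the quotient $\mathcal A/\mathcal N$ has the objects of $\mathcal A$, and two morphisms are identified if their difference factors over an object of $\mathcal N$.) A morphism of an additive category is split if it is isomorphic, as a diagram of shape $\bullet\to\bullet$, to a morphism $X\oplus Y\to Y\oplus Z$ which is the identity $Y\to Y$ and zero otherwise. A commutative quadrangle in $\mathcal C$ with horizontal morphisms $f:X\to Y$, $f':X'\to Y'$ and vertical morphisms $x:X\to X'$, $y:Y\to Y'$ is a weak square if $(x,f):X\to X'\oplus Y$ is a weak kernel of $\binom{f'}{-y}:X'\oplus Y\to Y'$. Let $\bar\Delta_n$ be the linearly ordered set consisting of $\mathbb Z$ copies of $\Delta_n=\{0<1<\dots<n\}$ put in a row, with shift $\alpha\mapsto\alpha^{+1}$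 to the next copy and inverse shift $\alpha\mapsto\alpha^{-1}$. Let $\bar\Delta_n^\#$ be the poset of pairs $\beta/\alpha$ of elements of $\bar\Delta_n$ with $\beta^{-1}\le\alpha\le\beta\le\alpha^{+1}$, ordered by $\beta/\alpha\le\delta/\gamma$ if and only if $\alpha\le\gamma$ and $\beta\le\delta$. An $n$-pretriangle is a $\mathcal C$-valued diagram $X$ on $\bar\Delta_n^\#$ such that $X_{\alpha/\alpha}$ and $X_{\alpha^{+1}/\alpha}$ are zero objects for all $\alpha$, and such that for all $\delta^{-1}\le\alpha\le\beta\le\gamma\le\delta\le\alpha^{+1}$ the quadrangle with horizontal morphisms $X_{\gamma/\alpha}\to X_{\delta/\alpha}$, $X_{\gamma/\beta}\to X_{\delta/\beta}$ and vertical morphisms $X_{\gamma/\alpha}\to X_{\gamma/\beta}$, $X_{\delta/\alpha}\to X_{\delta/\beta}$ is a weak square. Let $\mathcal C^+(\bar\Delta_n^\#)$ be the full subcategory of $n$-pretriangles in the category of diagrams, and let $\underline{\mathcal C^+(\bar\Delta_n^\#)}$ be its quotient modulo the full subcategory of those $n$-pretriangles all of whose diagram morphisms are split in $\hat{\mathcal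 C}$. Let $\dot\Delta_n=\{1<\dots<n\}$, embedded into $\bar\Delta_n^\#$ by $i\mapsto i/0$. Let $\mathcal C(\dot\Delta_n)$ be the category of $\mathcal C$-valued diagrams on $\dot\Delta_n$, and let $\underline{\mathcal C(\dot\Delta_n)}$ be its quotient modulo the full subcategory of those diagrams all of whose morphisms are split in $\hat{\mathcal C}$. Then the functor $$\underline{\mathcal C^+(\bar\Delta_n^\#)}\longrightarrow\underline{\mathcal C(\dot\Delta_n)},\qquad X\longmapsto X|_{\dot\Delta_n},$$ induced by restriction along $\dot\Delta_n\subseteq\bar\Delta_n^\#$, is an equivalence of categories. -/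

import Mathlib

open CategoryTheory CategoryTheory.Limits

universe v u

noncomputable section

namespace Heller

/-! ### Weakly abelian categories -/

section WeaklyAbelian

variable {C : Type u} [Category.{v} C] [Preadditive C]

/-- The morphism `i` is a weak kernel of `f`. -/
def IsWeakKernel {K X Y : C} (i : K ⟶ X) (f : X ⟶ Y) : Prop :=
  i ≫ f = 0 ∧ ∀ ⦃T : C⦄ (t : T ⟶ X), t ≫ f = 0 → ∃ t' : T ⟶ K, t' ≫ i = t

/-- The morphism `p` is a weak cokernel of `f`. -/
def IsWeakCokernel {X Y Q : C} (f : X ⟶ Y) (p : Y ⟶ Q) : Prop :=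
  f ≫ p = 0 ∧ ∀ ⦃T : C⦄ (t : Y ⟶ T), f ≫ t = 0 → ∃ t' : Q ⟶ T, p ≫ t' = t

end WeaklyAbelian

/-- A weakly abelian category: an additive category in which each morphism has a weak kernel and
a weak cokernel, and in which each morphism is a weak kernel and a weak cokernel. -/
class WeaklyAbelian (C : Type u) [Category.{v} C] [Preadditive C] [HasZeroObject C]
    [HasBinaryBiproducts C] : Prop where
  exists_weakKernel : ∀ {X Y : C} (f : X ⟶ Y), ∃ (K : C) (i : K ⟶ X), IsWeakKernel i f
  exists_weakCokernel : ∀ {X Y : C} (f : X ⟶ Y), ∃ (Q : C) (p : Y ⟶ Q), IsWeakCokernel f p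
  is_weakKernel : ∀ {X Y : C} (f : X ⟶ Y), ∃ (Z : C) (g : Y ⟶ Z), IsWeakKernel f g
  is_weakCokernel : ∀ {X Y : C} (f : X ⟶ Y), ∃ (W : C) (g : W ⟶ X), IsWeakCokernel g f

/-- The quadrangle with horizontal morphisms `f : X ⟶ Y`, `f' : X' ⟶ Y'` and vertical morphisms
`x : X ⟶ X'`, `y : Y ⟶ Y'` is a weak square: its diagonal sequence
`X ⟶ X' ⊞ Y ⟶ Y'` is exact in the middle, i.e. the first morphism `(x, f)` of it is a weak kernel
of the second morphism `(f', -y)`. This entails that the quadrangle commutes. -/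
def IsWeakSquare {C : Type u} [Category.{v} C] [Preadditive C] [HasBinaryBiproducts C]
    {X Y X' Y' : C} (f : X ⟶ Y) (x : X ⟶ X') (y : Y ⟶ Y') (f' : X' ⟶ Y') : Prop :=
  IsWeakKernel (biprod.lift x f) (biprod.desc f' (-y))

/-! ### Quotients by full subcategories -/

section Quotient

variable {A : Type u} [Category.{v} A] [Preadditive A]

/-- The morphism `f` factors over an object of `N`. -/
def FactorsOver (N : ObjectProperty A) {X Y : A} (f : X ⟶ Y) : Prop :=
  ∃ (Z : A) (a : X ⟶ Z) (b : Z ⟶ Y), N Z ∧ a ≫ b = f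

/-- Two morphisms are equivalent modulo `N` if their difference factors over an object of `N`. -/
def modRel (N : ObjectProperty A) : HomRel A :=
  fun _ _ f g => FactorsOver N (f - g)

/-- The quotient category `A/N`: it has the objects of `A`, and as morphisms the classes of
morphisms of `A` modulo `modRel N`. (Mathlib's `Quotient` identifies along the congruence
generated by the given relation; this is `modRel N` itself when the objects of `N` form an
additive subcategory.) -/
abbrev ModCat (N : ObjectProperty A) : Type u := CategoryTheory.Quotient (modRel N)

/-- The residue class functor `A ⥤ A/N`. -/
abbrev modFunctor (N : ObjectProperty A) : A ⥤ ModCat N := CategoryTheory.Quotient.functor _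

end Quotient

/-! ### The Freyd category and split morphisms -/

section Freyd

variable (C : Type u) [Category.{v} C] [Preadditive C]

/-- The arrows of `C` that are zero morphisms. -/
def zeroArrows : ObjectProperty (Arrow C) := fun u => u.hom = 0

/-- The Freyd category of `C`: the category of arrows of `C` modulo the zero arrows. -/
abbrev Freyd : Type _ := ModCat (zeroArrows C)

variable {C}

lemma modRel_zeroArrows_iff {s t : Arrow C} (f g : s ⟶ t) :
    modRel (zeroArrows C) f g ↔ (f.left - g.left) ≫ t.hom = 0 := by
  constructor
  · rintro ⟨Z, a, b, hZ, h⟩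
    have hl : f.left - g.left = a.left ≫ b.left := by
      rw [← Arrow.Hom.sub_left, ← h, Arrow.comp_left]
    have hZ' : Z.hom = 0 := hZ
    have hb : b.left ≫ t.hom = Z.hom ≫ b.right := Arrow.w b
    rw [hl, Category.assoc, hb, hZ', zero_comp, comp_zero]
  · intro h
    have h' : s.hom ≫ (f.right - g.right) = 0 := by
      have := Arrow.w (f - g)
      rw [Arrow.Hom.sub_left, Arrow.Hom.sub_right, h] at this
      exact this.symm
    refine ⟨Arrow.mk (0 : s.left ⟶ t.right),
      Arrow.homMk (𝟙 _) (f.right - g.right) (by simp [h']),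
      Arrow.homMk (f.left - g.left) (𝟙 _) (by simp [h]), rfl, ?_⟩
    ext <;> simp

instance : Congruence (modRel (zeroArrows C)) where
  equivalence := fun {s t} =>
    { refl := fun f => by simp [modRel_zeroArrows_iff]
      symm := fun {f g} h => by
        rw [modRel_zeroArrows_iff] at h ⊢
        rw [← neg_sub, Preadditive.neg_comp, h, neg_zero]
      trans := fun {f g k} h h' => by
        rw [modRel_zeroArrows_iff] at h h' ⊢
        rw [← sub_add_sub_cancel f.left g.left k.left, Preadditive.add_comp, h, h', add_zero] }
  comp_left := fun {r s t} f {g g'} h => by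
    rw [modRel_zeroArrows_iff] at h ⊢
    rw [Arrow.comp_left, Arrow.comp_left, ← Preadditive.comp_sub, Category.assoc, h, comp_zero]
  comp_right := fun {r s t} {f f'} g h => by
    rw [modRel_zeroArrows_iff] at h ⊢
    have hg : g.left ≫ t.hom = s.hom ≫ g.right := Arrow.w g
    rw [Arrow.comp_left, Arrow.comp_left, ← Preadditive.sub_comp, Category.assoc, hg,
      ← Category.assoc, h, zero_comp]

instance : Preadditive (Freyd C) :=
  CategoryTheory.Quotient.preadditive _ (fun {s t} f₁ f₂ g₁ g₂ h h' => by
    rw [modRel_zeroArrows_iff] at h h' ⊢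
    rw [Arrow.Hom.add_left, Arrow.Hom.add_left, add_sub_add_comm, Preadditive.add_comp, h, h',
      add_zero])

variable (C) in
/-- The embedding of `C` into its Freyd category, sending `X` to the arrow `𝟙 X`. -/
def toFreyd : C ⥤ Freyd C where
  obj X := (modFunctor (zeroArrows C)).obj (Arrow.mk (𝟙 X))
  map f := (modFunctor (zeroArrows C)).map (Arrow.homMk f f)
  map_id X := by
    exact (modFunctor (zeroArrows C)).map_id (Arrow.mk (𝟙 X))
  map_comp f g := by
    rw [← Functor.map_comp]
    rfl

end Freyd

/-- A morphism in an additive category is split if it is isomorphic, as an arrow, to a morphism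
`X ⊕ Y ⟶ Y ⊕ Z` that is the identity from the summand `Y` to the summand `Y` and zero otherwise. -/
def IsSplit {A : Type u} [Category.{v} A] [Preadditive A] {U V : A} (f : U ⟶ V) : Prop :=
  ∃ (X Y Z : A) (b : BinaryBicone X Y) (c : BinaryBicone Y Z),
    Nonempty b.IsBilimit ∧ Nonempty c.IsBilimit ∧
      Nonempty (Arrow.mk f ≅ Arrow.mk (b.snd ≫ c.inl))

/-- The `C`-valued diagrams on `D` all of whose morphisms are split in the Freyd category
of `C`. -/
def splitDiagrams (D : Type*) [Category* D] (C : Type u) [Category.{v} C] [Preadditive C] :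
    ObjectProperty (D ⥤ C) :=
  fun X => ∀ ⦃d e : D⦄ (a : d ⟶ e), IsSplit ((toFreyd C).map (X.map a))

/-! ### The strip -/

/-- The shift `α ↦ α⁺¹` of the periodic repetition of `{0 < 1 < ⋯ < n}`. This periodic repetition,
i.e. `ℤ` copies of `{0 < 1 < ⋯ < n}` put in a row, is the linearly ordered set `ℤ`: the element `α`
of the copy number `z` corresponds to `α + (n + 1) * z`. The shift sends each element to the same
element of the next copy. -/
abbrev shift (n : ℕ) (α : ℤ) : ℤ := α + (n + 1)

lemma le_shift (n : ℕ) (α : ℤ) : α ≤ shift n α := by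
  unfold shift
  omega

lemma shift_mono (n : ℕ) {α β : ℤ} (h : α ≤ β) : shift n α ≤ shift n β := by
  unfold shift
  omega

/-- The identification of `ℤ` copies of `{0 < 1 < ⋯ < n}` put in a row with `ℤ`. -/
def barDeltaIso (n : ℕ) : ℤ ×ₗ Fin (n + 1) ≃o ℤ where
  toFun p := ((ofLex p).2 : ℕ) + (n + 1) * (ofLex p).1
  invFun k := toLex ((Int.divModEquiv (n + 1)) k)
  left_inv p := by
    have h := (Int.divModEquiv (n + 1)).right_inv (ofLex p)
    apply ofLex.injective
    simpa [Int.divModEquiv, add_comm, mul_comm] using h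
  right_inv k := by
    have h := (Int.divModEquiv (n + 1)).left_inv k
    simpa [Int.divModEquiv, add_comm, mul_comm] using h
  map_rel_iff' := by
    intro p q
    have hp := (ofLex p).2.isLt
    have hq := (ofLex q).2.isLt
    rw [Prod.Lex.le_iff, Fin.le_def]
    simp only [Equiv.coe_fn_mk]
    constructor
    · intro h
      rcases lt_trichotomy (ofLex p).1 (ofLex q).1 with hlt | heq | hgt
      · exact Or.inl hlt
      · exact Or.inr ⟨heq, by rw [heq] at h; linarith [h]⟩
      · exfalso
        nlinarith
    · rintro (h | ⟨h, h'⟩)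
      · nlinarith
      · rw [h]
        omega

lemma barDeltaIso_shift (n : ℕ) (z : ℤ) (α : Fin (n + 1)) :
    barDeltaIso n (toLex (z + 1, α)) =
      shift n (barDeltaIso n (toLex (z, α))) := by
  change ((α : ℕ) : ℤ) + (n + 1) * (z + 1) = ((α : ℕ) + (n + 1) * z) + (n + 1)
  ring

/-- The strip of the periodic repetition of `{0 < 1 < ⋯ < n}`: the pairs `(α, β)`, written `β/α`,
with `β⁻¹ ≤ α ≤ β ≤ α⁺¹` (where `β⁻¹ ≤ α` just means `β ≤ α⁺¹`), ordered componentwise. -/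
abbrev Strip (n : ℕ) : Type :=
  {p : ℤ × ℤ // p.1 ≤ p.2 ∧ p.2 ≤ shift n p.1}

/-- The element `β/α` of the strip. -/
abbrev Strip.mk {n : ℕ} (α β : ℤ) (h₁ : α ≤ β) (h₂ : β ≤ shift n α) : Strip n :=
  ⟨(α, β), h₁, h₂⟩

/-- The morphism of the strip from `β/α` to `δ/γ`, for `α ≤ γ` and `β ≤ δ`. -/
abbrev Strip.hom {n : ℕ} {p q : Strip n} (h₁ : p.1.1 ≤ q.1.1) (h₂ : p.1.2 ≤ q.1.2) : p ⟶ q :=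
  homOfLE (show p ≤ q from ⟨h₁, h₂⟩)

/-! ### Pretriangles -/

section Pretriangles

variable (C : Type u) [Category.{v} C] [Preadditive C] [HasBinaryBiproducts C] (n : ℕ)

/-- The `n`-pretriangles among the `C`-valued diagrams on the strip: there are zero objects at
`α/α` and at `α⁺¹/α`, and for `δ⁻¹ ≤ α ≤ β ≤ γ ≤ δ ≤ α⁺¹` the quadrangle on
`γ/α`, `δ/α`, `γ/β`, `δ/β` is a weak square. -/
structure IsPretriangle (X : Strip n ⥤ C) : Prop where
  isZero_diag : ∀ α : ℤ,
    IsZero (X.obj (Strip.mk α α le_rfl (le_shift n α)))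
  isZero_shift : ∀ α : ℤ,
    IsZero (X.obj (Strip.mk α (shift n α) (le_shift n α) le_rfl))
  isWeakSquare : ∀ (α β γ δ : ℤ) (hαβ : α ≤ β) (hβγ : β ≤ γ) (hγδ : γ ≤ δ)
    (hδα : δ ≤ shift n α),
    IsWeakSquare
      (X.map (Strip.hom
        (p := Strip.mk α γ (hαβ.trans hβγ) (hγδ.trans hδα))
        (q := Strip.mk α δ ((hαβ.trans hβγ).trans hγδ) hδα) le_rfl hγδ))
      (X.map (Strip.hom
        (p := Strip.mk α γ (hαβ.trans hβγ) (hγδ.trans hδα))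
        (q := Strip.mk β γ hβγ (hγδ.trans (hδα.trans (shift_mono n hαβ)))) hαβ le_rfl))
      (X.map (Strip.hom
        (p := Strip.mk α δ ((hαβ.trans hβγ).trans hγδ) hδα)
        (q := Strip.mk β δ (hβγ.trans hγδ) (hδα.trans (shift_mono n hαβ))) hαβ le_rfl))
      (X.map (Strip.hom
        (p := Strip.mk β γ hβγ (hγδ.trans (hδα.trans (shift_mono n hαβ))))
        (q := Strip.mk β δ (hβγ.trans hγδ) (hδα.trans (shift_mono n hαβ))) le_rfl hγδ))

/-- The category of `n`-pretriangles, a full subcategory of the category of diagrams on the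
strip. -/
abbrev Pretriangle : Type _ :=
  ObjectProperty.FullSubcategory (fun X : Strip n ⥤ C => IsPretriangle C n X)

/-- The split `n`-pretriangles. -/
def splitPretriangles : ObjectProperty (Pretriangle C n) :=
  fun X => splitDiagrams (Strip n) C X.obj

/-- The stable category of `n`-pretriangles. -/
abbrev StablePretriangle : Type _ := ModCat (splitPretriangles C n)

/-- The linearly ordered set `{1 < 2 < ⋯ < n}`. -/
abbrev DotDelta : Type := Set.Icc (1 : ℤ) (n : ℤ)

/-- The stable category of `C`-valued diagrams on `DotDelta n`. -/
abbrev StableDiagram : Type _ := ModCat (splitDiagrams (DotDelta n) C)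

/-- The embedding `i ↦ i/0` of `DotDelta n` into the strip. -/
def dotInclusion : DotDelta n ⥤ Strip n :=
  Monotone.functor
    (f := fun i : DotDelta n => Strip.mk (n := n) 0 i.1
      (by have := i.2.1; omega) (by have := i.2.2; unfold shift; omega))
    (fun _ _ h => ⟨le_rfl, h⟩)

/-- The restriction of `n`-pretriangles to `DotDelta n`. -/
def restriction : Pretriangle C n ⥤ (DotDelta n ⥤ C) :=
  ObjectProperty.ι _ ⋙ (Functor.whiskeringLeft _ _ C).obj (dotInclusion n)

lemma modRel_restriction {X Y : Pretriangle C n} (f g : X ⟶ Y)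
    (h : modRel (splitPretriangles C n) f g) :
    modRel (splitDiagrams (DotDelta n) C) ((restriction C n).map f) ((restriction C n).map g) := by
  obtain ⟨Z, a, b, hZ, h⟩ := h
  refine ⟨(restriction C n).obj Z, (restriction C n).map a, (restriction C n).map b,
    fun d e t => hZ ((dotInclusion n).map t), ?_⟩
  rw [← Functor.map_comp, h]
  rfl

/-- The functor induced on the stable categories by restriction. -/
def stableRestriction : StablePretriangle C n ⥤ StableDiagram C n :=
  CategoryTheory.Quotient.lift _ (restriction C n ⋙ modFunctor (splitDiagrams (DotDelta n) C))
    (fun _ _ f g h => CategoryTheory.Quotient.sound _ (modRel_restriction C n f g h))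

end Pretriangles

end Heller

end

/-!
Everything takes place inside `C`; the Freyd category enters only through the remark that a
morphism `f` of `C` is split there if and only if it is von Neumann regular, `f ≫ g ≫ f = f` for
some `g` (`isSplit_toFreyd_map_iff`). Indeed an idempotent `e` of `C`, considered as an object of
the Freyd category, splits itself. Exactness in a weakly abelian category is self-dual, so that the
weak squares of a pretriangle are at once weak pullbacks and weak pushouts
(`IsWeakSquare.isExactSquare`).

*Density.* A diagram on `{1 < ⋯ < n}` is extended by zero to row zero of the strip. The following
rows are built by weak pushouts and the preceding ones by weak pullbacks, one column after the
other and with zero objects prescribed on the boundary (`exists_rows`). Since weak squares can be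
pasted, this yields a pretriangle.

*Free pretriangles.* Given a family of objects `A p`, the direct sum over all points `p` of the
diagrams that are constant on the rectangle starting at `p`, with value `A p`, and zero elsewhere is
a split pretriangle. The free pretriangle on the objects of a pretriangle `Y` has a pointwise split
epimorphism to `Y` (`freeCounit`).

*Lifting.* The central statement is `exists_lift`: a morphism of pretriangles `X ⟶ Y` lifts along a
pointwise split epimorphism of pretriangles `W ⟶ Y` as soon as it lifts in row zero; the lift may be
prescribed there. It has two consequences. For `Y = 0`, every morphism in row zero extends to a
morphism of pretriangles, i.e. restriction is full. For `W` free on `Y`, a morphism to `Y` that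
vanishes in row zero factors over a split pretriangle.

*Faithfulness.* If the restrictions of `f` and `g` differ by a morphism that factors over a split
diagram `Z`, extend `Z` to a pretriangle. Up to a morphism that vanishes in row zero, `f` and `g`
differ by a morphism that factors over this extension. So it suffices that the extension is a direct
summand of the free pretriangle on it. By the lifting statement, a section is only needed in row
zero, and there it exists because chains of regular morphisms are projective
(`exists_section_of_isRegular`). The relation that defines the stable category of diagrams is not
known to be transitive a priori, but a chain of such relations can be lifted link by link, because
restriction is full.
-/

noncomputable section

namespace Heller

/-! ### Split morphisms are the von Neumann regular ones -/

/-- A morphism is von Neumann regular if it has a quasi-inverse. -/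
def IsRegular {A : Type u} [Category.{v} A] {U V : A} (f : U ⟶ V) : Prop :=
  ∃ g : V ⟶ U, f ≫ g ≫ f = f

lemma IsRegular.of_arrow_iso {A : Type u} [Category.{v} A] {U V U' V' : A} {f : U ⟶ V}
    {f' : U' ⟶ V'} (hf : IsRegular f) (e : Arrow.mk f' ≅ Arrow.mk f) : IsRegular f' := by
  obtain ⟨g, hg⟩ := hf
  have h₁ : e.hom.left ≫ f = f' ≫ e.hom.right := Arrow.w e.hom
  have h₂ : e.inv.left ≫ f' = f ≫ e.inv.right := Arrow.w e.inv
  have h₃ : e.hom.right ≫ e.inv.right = 𝟙 V' := by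
    rw [← Arrow.comp_right, e.hom_inv_id]
    rfl
  refine ⟨e.hom.right ≫ g ≫ e.inv.left, ?_⟩
  calc f' ≫ (e.hom.right ≫ g ≫ e.inv.left) ≫ f'
      = (f' ≫ e.hom.right) ≫ g ≫ (e.inv.left ≫ f') := by simp only [Category.assoc]
    _ = e.hom.left ≫ (f ≫ g ≫ f) ≫ e.inv.right := by
      rw [← h₁, h₂]; simp only [Category.assoc]
    _ = f' := by rw [hg, ← Category.assoc, h₁, Category.assoc, h₃, Category.comp_id]

lemma isRegular_zero {A : Type u} [Category.{v} A] [Preadditive A] (U V : A) :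
    IsRegular (0 : U ⟶ V) :=
  ⟨0, by simp⟩

lemma IsSplit.isRegular {A : Type u} [Category.{v} A] [Preadditive A] {U V : A} {f : U ⟶ V}
    (hf : IsSplit f) : IsRegular f := by
  obtain ⟨X, Y, Z, b, c, -, -, ⟨e⟩⟩ := hf
  exact IsRegular.of_arrow_iso ⟨c.fst ≫ b.inr, by simp⟩ e

/-- A regular morphism is split as soon as the idempotents belonging to its kernel, to its image
and to its cokernel split. -/
lemma isSplit_of_splittings {A : Type u} [Category.{v} A] [Preadditive A] {U V X Y Z : A}
    {f : U ⟶ V} {g : V ⟶ U} (hfg : f ≫ g ≫ f = f)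
    (iX : X ⟶ U) (pX : U ⟶ X) (hX : iX ≫ pX = 𝟙 X) (hX' : pX ≫ iX = 𝟙 U - f ≫ g)
    (iY : Y ⟶ U) (pY : U ⟶ Y) (hY : iY ≫ pY = 𝟙 Y) (hY' : pY ≫ iY = f ≫ g)
    (iZ : Z ⟶ V) (pZ : V ⟶ Z) (hZ : iZ ≫ pZ = 𝟙 Z) (hZ' : pZ ≫ iZ = 𝟙 V - g ≫ f) :
    IsSplit f := by
  have hfgf : (f ≫ g) ≫ f = f := by simpa using hfg
  have hX₁ : iX ≫ f = 0 := by
    have : iX ≫ (pX ≫ iX) ≫ f = iX ≫ f := by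
      rw [Category.assoc, ← Category.assoc, hX, Category.id_comp]
    rw [← this, hX', Preadditive.sub_comp, hfgf]; simp
  have hX₂ : (f ≫ g) ≫ pX = 0 := by
    have : (f ≫ g) ≫ (pX ≫ iX) ≫ pX = (f ≫ g) ≫ pX := by
      rw [Category.assoc pX, hX, Category.comp_id]
    rw [← this, hX', Preadditive.sub_comp, Preadditive.comp_sub, Category.id_comp,
      ← Category.assoc (f ≫ g) (f ≫ g), ← Category.assoc (f ≫ g) f, hfgf, sub_self]
  have hY₁ : iY ≫ f ≫ g = iY := by rw [← hY', ← Category.assoc, hY, Category.id_comp]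
  have hY₂ : (f ≫ g) ≫ pY = pY := by rw [← hY', Category.assoc, hY, Category.comp_id]
  have hZ₁ : f ≫ pZ = 0 := by
    have : f ≫ (pZ ≫ iZ) ≫ pZ = f ≫ pZ := by rw [Category.assoc pZ, hZ, Category.comp_id]
    rw [← this, hZ', Preadditive.sub_comp, Preadditive.comp_sub, Category.id_comp,
      ← Category.assoc f (g ≫ f), hfg, sub_self]
  have hZ₂ : iZ ≫ g ≫ f = 0 := by
    have h : iZ ≫ (pZ ≫ iZ) = iZ := by rw [← Category.assoc, hZ, Category.id_comp]
    rw [hZ', Preadditive.comp_sub, Category.comp_id, sub_eq_self] at h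
    exact h
  let b : BinaryBicone X Y :=
    { pt := U, fst := pX, snd := pY, inl := iX, inr := iY
      inl_fst := hX
      inl_snd := by rw [← hY₂, ← Category.assoc, ← Category.assoc, hX₁]; simp
      inr_fst := by rw [← hY₁, Category.assoc, hX₂, comp_zero]
      inr_snd := hY }
  let c : BinaryBicone Y Z :=
    { pt := V, fst := g ≫ f ≫ g ≫ pY, snd := pZ, inl := iY ≫ f, inr := iZ
      inl_fst := by
        have : (iY ≫ f) ≫ g ≫ f ≫ g ≫ pY = (iY ≫ f ≫ g) ≫ (f ≫ g) ≫ pY := by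
          simp only [Category.assoc]
        rw [this, hY₁, hY₂, hY]
      inl_snd := by rw [Category.assoc, hZ₁, comp_zero]
      inr_fst := by
        have : iZ ≫ g ≫ f ≫ g ≫ pY = (iZ ≫ g ≫ f) ≫ g ≫ pY := by simp only [Category.assoc]
        rw [this, hZ₂, zero_comp]
      inr_snd := hZ }
  refine ⟨X, Y, Z, b, c, ⟨isBinaryBilimitOfTotal b ?_⟩, ⟨isBinaryBilimitOfTotal c ?_⟩, ⟨?_⟩⟩
  · change pX ≫ iX + pY ≫ iY = 𝟙 U
    rw [hX', hY', sub_add_cancel]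
  · change (g ≫ f ≫ g ≫ pY) ≫ iY ≫ f + pZ ≫ iZ = 𝟙 V
    have : (g ≫ f ≫ g ≫ pY) ≫ iY ≫ f = g ≫ ((f ≫ g) ≫ pY ≫ iY) ≫ f := by
      simp only [Category.assoc]
    rw [this, hY', hZ', Category.assoc (f ≫ g), hfgf, hfgf, add_sub_cancel]
  · refine Arrow.isoMk (Iso.refl _) (Iso.refl _) ?_
    change 𝟙 U ≫ pY ≫ iY ≫ f = f ≫ 𝟙 V
    rw [Category.id_comp, Category.comp_id, ← Category.assoc, hY', hfgf]

section Freyd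

variable {C : Type u} [Category.{v} C] [Preadditive C]

instance : (toFreyd C).Additive where
  map_add {X Y f g} := by
    exact congrArg (modFunctor (zeroArrows C)).map
      (show (Arrow.homMk (f + g) (f + g) : Arrow.mk (𝟙 X) ⟶ Arrow.mk (𝟙 Y)) =
        Arrow.homMk f f + Arrow.homMk g g by ext <;> rfl)

instance : (toFreyd C).Faithful where
  map_injective {X Y f g} h := by
    have := (CategoryTheory.Quotient.functor_map_eq_iff (modRel (zeroArrows C)) _ _).1 h
    rw [modRel_zeroArrows_iff] at this
    simpa [sub_eq_zero] using this

instance : (toFreyd C).Full where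
  map_surjective {X Y} f := by
    obtain ⟨g, rfl⟩ := (modFunctor (zeroArrows C)).map_surjective f
    refine ⟨g.left, ?_⟩
    apply CategoryTheory.Quotient.sound
    rw [modRel_zeroArrows_iff]
    simp

/-- Every idempotent of `C` splits in the Freyd category, over itself considered as an object:
the object `e` of the Freyd category is the image of the morphism `e`. -/
lemma exists_splitting_toFreyd {U : C} (e : U ⟶ U) (he : e ≫ e = e) :
    ∃ (Y : Freyd C) (i : Y ⟶ (toFreyd C).obj U) (p : (toFreyd C).obj U ⟶ Y),
      i ≫ p = 𝟙 Y ∧ p ≫ i = (toFreyd C).map e := by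
  refine ⟨(modFunctor (zeroArrows C)).obj (Arrow.mk e),
    (modFunctor (zeroArrows C)).map (Arrow.homMk e (𝟙 U) rfl),
    (modFunctor (zeroArrows C)).map (Arrow.homMk (𝟙 U) e rfl), ?_, ?_⟩
  · refine ((modFunctor (zeroArrows C)).map_comp _ _).symm.trans
      (Eq.trans ?_ ((modFunctor (zeroArrows C)).map_id _))
    apply CategoryTheory.Quotient.sound
    rw [modRel_zeroArrows_iff]
    simp [he]
  · refine ((modFunctor (zeroArrows C)).map_comp _ _).symm.trans
      (congrArg (modFunctor (zeroArrows C)).map ?_)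
    ext <;> simp

theorem isSplit_toFreyd_map_iff {U V : C} (f : U ⟶ V) :
    IsSplit ((toFreyd C).map f) ↔ IsRegular f := by
  constructor
  · intro h
    obtain ⟨g, hg⟩ := h.isRegular
    obtain ⟨g, rfl⟩ := (toFreyd C).map_surjective g
    exact ⟨g, (toFreyd C).map_injective (by simpa using hg)⟩
  · rintro ⟨g, hg⟩
    have h₁ : (f ≫ g) ≫ f ≫ g = f ≫ g := by
      rw [← Category.assoc, Category.assoc f, hg]
    have h₂ : (g ≫ f) ≫ g ≫ f = g ≫ f := by
      rw [Category.assoc, hg]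
    obtain ⟨X, iX, pX, hX, hX'⟩ := exists_splitting_toFreyd (𝟙 U - f ≫ g) (by simp [h₁])
    obtain ⟨Y, iY, pY, hY, hY'⟩ := exists_splitting_toFreyd (f ≫ g) h₁
    obtain ⟨Z, iZ, pZ, hZ, hZ'⟩ := exists_splitting_toFreyd (𝟙 V - g ≫ f) (by simp [h₂])
    refine isSplit_of_splittings (g := (toFreyd C).map g) ?_ iX pX hX ?_ iY pY hY ?_ iZ pZ hZ ?_
    · rw [← Functor.map_comp, ← Functor.map_comp, hg]
    · rw [hX', Functor.map_sub, Functor.map_comp, CategoryTheory.Functor.map_id]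
    · rw [hY', Functor.map_comp]
    · rw [hZ', Functor.map_sub, Functor.map_comp, CategoryTheory.Functor.map_id]

lemma splitDiagrams_iff {D : Type*} [Category* D] (X : D ⥤ C) :
    splitDiagrams D C X ↔ ∀ ⦃d e : D⦄ (a : d ⟶ e), IsRegular (X.map a) := by
  simp only [splitDiagrams, isSplit_toFreyd_map_iff]

end Freyd

/-! ### Weak squares -/

section ExactSquare

variable {C : Type u} [Category.{v} C]

/-- A commutative quadrangle that is a weak pullback and a weak pushout. -/
structure IsExactSquare {X Y X' Y' : C} (f : X ⟶ Y) (x : X ⟶ X') (y : Y ⟶ Y')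
    (f' : X' ⟶ Y') : Prop where
  w : f ≫ y = x ≫ f'
  exists_lift : ∀ ⦃T : C⦄ (a : T ⟶ X') (b : T ⟶ Y), a ≫ f' = b ≫ y →
    ∃ t : T ⟶ X, t ≫ x = a ∧ t ≫ f = b
  exists_desc : ∀ ⦃T : C⦄ (a : X' ⟶ T) (b : Y ⟶ T), x ≫ a = f ≫ b →
    ∃ t : Y' ⟶ T, f' ≫ t = a ∧ y ≫ t = b

lemma IsExactSquare.flip {X Y X' Y' : C} {f : X ⟶ Y} {x : X ⟶ X'} {y : Y ⟶ Y'} {f' : X' ⟶ Y'}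
    (h : IsExactSquare f x y f') : IsExactSquare x f f' y where
  w := h.w.symm
  exists_lift T a b hab := by
    obtain ⟨t, h₁, h₂⟩ := h.exists_lift b a hab.symm
    exact ⟨t, h₂, h₁⟩
  exists_desc T a b hab := by
    obtain ⟨t, h₁, h₂⟩ := h.exists_desc b a hab.symm
    exact ⟨t, h₂, h₁⟩

lemma IsExactSquare.paste {X Y Z X' Y' Z' : C} {f : X ⟶ Y} {g : Y ⟶ Z} {x : X ⟶ X'}
    {y : Y ⟶ Y'} {z : Z ⟶ Z'} {f' : X' ⟶ Y'} {g' : Y' ⟶ Z'} (h : IsExactSquare f x y f')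
    (k : IsExactSquare g y z g') : IsExactSquare (f ≫ g) x z (f' ≫ g') where
  w := by rw [Category.assoc, k.w, ← Category.assoc, h.w, Category.assoc]
  exists_lift T a b hab := by
    obtain ⟨t, h₁, h₂⟩ := k.exists_lift (a ≫ f') b (by rw [Category.assoc, hab])
    obtain ⟨s, h₃, h₄⟩ := h.exists_lift a t h₁.symm
    exact ⟨s, h₃, by rw [← Category.assoc, h₄, h₂]⟩
  exists_desc T a b hab := by
    obtain ⟨t, h₁, h₂⟩ := h.exists_desc a (g ≫ b) (by rw [hab, Category.assoc])
    obtain ⟨s, h₃, h₄⟩ := k.exists_desc t b h₂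
    exact ⟨s, by rw [Category.assoc, h₃, h₁], h₄⟩

lemma isExactSquare_id {X X' : C} (x : X ⟶ X') : IsExactSquare (𝟙 X) x x (𝟙 X') where
  w := by simp
  exists_lift T a b hab := ⟨b, by simpa using hab.symm, by simp⟩
  exists_desc T a b hab := ⟨a, by simp, by simpa using hab⟩

variable [Preadditive C] [HasBinaryBiproducts C]

lemma isWeakSquare_iff_weakPullback {X Y X' Y' : C} (f : X ⟶ Y) (x : X ⟶ X') (y : Y ⟶ Y')
    (f' : X' ⟶ Y') : IsWeakSquare f x y f' ↔ f ≫ y = x ≫ f' ∧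
      ∀ ⦃T : C⦄ (a : T ⟶ X') (b : T ⟶ Y), a ≫ f' = b ≫ y → ∃ t : T ⟶ X, t ≫ x = a ∧ t ≫ f = b := by
  have key : ∀ {T : C} (a : T ⟶ X') (b : T ⟶ Y),
      biprod.lift a b ≫ biprod.desc f' (-y) = 0 ↔ a ≫ f' = b ≫ y := by
    intro T a b
    rw [biprod.lift_desc, Preadditive.comp_neg, ← sub_eq_add_neg, sub_eq_zero]
  constructor
  · rintro ⟨h₁, h₂⟩
    refine ⟨((key _ _).1 h₁).symm, fun T a b hab => ?_⟩
    obtain ⟨t, ht⟩ := h₂ (biprod.lift a b) ((key _ _).2 hab)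
    exact ⟨t, by simpa using congr($ht ≫ biprod.fst), by simpa using congr($ht ≫ biprod.snd)⟩
  · rintro ⟨h₁, h₂⟩
    refine ⟨(key _ _).2 h₁.symm, fun T t ht => ?_⟩
    obtain ⟨s, hs, hs'⟩ := h₂ (t ≫ biprod.fst) (t ≫ biprod.snd) (by
      rw [← key]
      convert ht
      ext <;> simp)
    exact ⟨s, by ext <;> simp [hs, hs']⟩

lemma IsExactSquare.isWeakSquare {X Y X' Y' : C} {f : X ⟶ Y} {x : X ⟶ X'} {y : Y ⟶ Y'}
    {f' : X' ⟶ Y'} (h : IsExactSquare f x y f') : IsWeakSquare f x y f' :=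
  (isWeakSquare_iff_weakPullback _ _ _ _).2 ⟨h.w, h.exists_lift⟩

variable [HasZeroObject C] [WeaklyAbelian C]

/-- Exactness in a weakly abelian category is self-dual. -/
lemma isWeakCokernel_of_isWeakKernel {K X Y : C} {i : K ⟶ X} {f : X ⟶ Y}
    (h : IsWeakKernel i f) : IsWeakCokernel i f := by
  refine ⟨h.1, fun T t ht => ?_⟩
  obtain ⟨W, g, hg, hg'⟩ := WeaklyAbelian.is_weakCokernel f
  obtain ⟨g', rfl⟩ := h.2 g hg
  exact hg' t (by rw [Category.assoc, ht, comp_zero])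

lemma isWeakKernel_of_isWeakCokernel {X Y Q : C} {f : X ⟶ Y} {p : Y ⟶ Q}
    (h : IsWeakCokernel f p) : IsWeakKernel f p := by
  refine ⟨h.1, fun T t ht => ?_⟩
  obtain ⟨W, g, hg, hg'⟩ := WeaklyAbelian.is_weakKernel f
  obtain ⟨g', rfl⟩ := h.2 g hg
  exact hg' t (by rw [← Category.assoc, ht, zero_comp])

lemma IsWeakSquare.isExactSquare {X Y X' Y' : C} {f : X ⟶ Y} {x : X ⟶ X'} {y : Y ⟶ Y'}
    {f' : X' ⟶ Y'} (h : IsWeakSquare f x y f') : IsExactSquare f x y f' where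
  w := ((isWeakSquare_iff_weakPullback _ _ _ _).1 h).1
  exists_lift := ((isWeakSquare_iff_weakPullback _ _ _ _).1 h).2
  exists_desc T a b hab := by
    obtain ⟨t, ht⟩ := (isWeakCokernel_of_isWeakKernel h).2 (biprod.desc a (-b)) (by
      rw [biprod.lift_desc, Preadditive.comp_neg, hab, add_neg_cancel])
    refine ⟨t, by simpa using congr(biprod.inl ≫ $ht), ?_⟩
    simpa using congr(biprod.inr ≫ $ht)

lemma exists_exactSquare_of_span {X Y X' : C} (f : X ⟶ Y) (x : X ⟶ X') :
    ∃ (Y' : C) (y : Y ⟶ Y') (f' : X' ⟶ Y'), IsExactSquare f x y f' := by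
  obtain ⟨Q, p, hp⟩ := WeaklyAbelian.exists_weakCokernel (biprod.lift x f)
  refine ⟨Q, -(biprod.inr ≫ p), biprod.inl ≫ p, IsWeakSquare.isExactSquare ?_⟩
  have : biprod.desc (biprod.inl ≫ p) (- -(biprod.inr ≫ p)) = p := by ext <;> simp
  rw [IsWeakSquare, this]
  exact isWeakKernel_of_isWeakCokernel hp

lemma exists_exactSquare_of_cospan {Y X' Y' : C} (y : Y ⟶ Y') (f' : X' ⟶ Y') :
    ∃ (X : C) (f : X ⟶ Y) (x : X ⟶ X'), IsExactSquare f x y f' := by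
  obtain ⟨K, i, hi⟩ := WeaklyAbelian.exists_weakKernel (biprod.desc f' (-y))
  refine ⟨K, i ≫ biprod.snd, i ≫ biprod.fst, IsWeakSquare.isExactSquare ?_⟩
  have : biprod.lift (i ≫ biprod.fst) (i ≫ biprod.snd) = i := by ext <;> simp
  rw [IsWeakSquare, this]
  exact hi

end ExactSquare

/-! ### Sequences indexed by the integers -/

/-- Dependent choice in both directions, starting from a given term at `b`. -/
lemma exists_int_sequence {S : ℤ → Type*} (R : ∀ j k, S j → S k → Prop) (b : ℤ) (s₀ : S b)
    (up : ∀ k, b ≤ k → ∀ s : S k, ∃ s' : S (k + 1), R k (k + 1) s s')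
    (down : ∀ k, k ≤ b → ∀ s : S k, ∃ s' : S (k - 1), R (k - 1) k s' s) :
    ∃ s : ∀ k, S k, s b = s₀ ∧ ∀ k, R k (k + 1) (s k) (s (k + 1)) := by
  choose up hup using up
  choose down hdown using down
  refine ⟨fun k => k.inductionOn' b s₀ up down, Int.inductionOn'_self, fun k => ?_⟩
  rcases le_or_gt b k with h | h
  · simp only [Int.inductionOn'_add_one h]
    exact hup k h _
  · have key : ∀ j, j ≤ b → R (j - 1) j ((j - 1).inductionOn' b s₀ up down)
        (j.inductionOn' b s₀ up down) := fun j hj => by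
      rw [Int.inductionOn'_sub_one hj]
      exact hdown j hj _
    have := key (k + 1) h
    rwa [add_sub_cancel_right] at this

section Functor

variable {D : Type u} [Category.{v} D]

/-- The morphism `k ⟶ k + 1` of the poset of integers. -/
abbrev intStep (k : ℤ) : k ⟶ k + 1 := homOfLE (Int.le_add_one le_rfl)

/-- The composite `X i ⟶ X j` of the morphisms `f k : X k ⟶ X (k + 1)`, for `i ≤ j`. -/
def intMap {X : ℤ → D} (f : ∀ k, X k ⟶ X (k + 1)) (i : ℤ) : ∀ j, i ≤ j → (X i ⟶ X j) :=
  Int.leInduction (motive := fun j _ => X i ⟶ X j) (𝟙 _) (fun j _ g => g ≫ f j)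

lemma intMap_self {X : ℤ → D} (f : ∀ k, X k ⟶ X (k + 1)) (i : ℤ) (h : i ≤ i) :
    intMap f i i h = 𝟙 _ :=
  Int.leInduction_base _ _

lemma intMap_add_one {X : ℤ → D} (f : ∀ k, X k ⟶ X (k + 1)) (i j : ℤ) (h : i ≤ j)
    (h' : i ≤ j + 1) : intMap f i (j + 1) h' = intMap f i j h ≫ f j :=
  Int.leInduction_add_one (motive := fun j _ => X i ⟶ X j) _ _ _ h

/-- The functor on `ℤ` with given objects and given morphisms between neighbours. -/
def functorOfSteps {X : ℤ → D} (f : ∀ k, X k ⟶ X (k + 1)) : ℤ ⥤ D where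
  obj := X
  map {i j} a := intMap f i j (leOfHom a)
  map_id i := intMap_self f i _
  map_comp {i j k} a b := by
    have key : ∀ k (h : j ≤ k), intMap f i k ((leOfHom a).trans h) =
        intMap f i j (leOfHom a) ≫ intMap f j k h := by
      refine Int.leInduction ?_ fun k h ih => ?_
      · rw [intMap_self, Category.comp_id]
      · rw [intMap_add_one f i k ((leOfHom a).trans h), ih, intMap_add_one f j k h,
          Category.assoc]
    exact key k (leOfHom b)

lemma functorOfSteps_map_intStep {X : ℤ → D} (f : ∀ k, X k ⟶ X (k + 1)) (k : ℤ) :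
    (functorOfSteps f).map (intStep k) = f k :=
  (intMap_add_one f k k le_rfl _).trans (by rw [intMap_self, Category.id_comp])

lemma map_homOfLE_add_one (F : ℤ ⥤ D) {i j : ℤ} (h : i ≤ j) (h' : i ≤ j + 1) :
    F.map (homOfLE h') = F.map (homOfLE h) ≫ F.map (intStep j) := by
  rw [← F.map_comp]
  rfl

/-- A transformation between functors on `ℤ` that is natural for steps is natural. -/
def natTransOfSteps {F G : ℤ ⥤ D} (app : ∀ k, F.obj k ⟶ G.obj k)
    (h : ∀ k, F.map (intStep k) ≫ app (k + 1) = app k ≫ G.map (intStep k)) : F ⟶ G where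
  app := app
  naturality i j a := by
    have key : ∀ j (hij : i ≤ j),
        F.map (homOfLE hij) ≫ app j = app i ≫ G.map (homOfLE hij) := by
      refine Int.leInduction ?_ fun j hij ih => ?_
      · have hF : F.map (homOfLE (le_refl i)) = 𝟙 _ := F.map_id i
        have hG : G.map (homOfLE (le_refl i)) = 𝟙 _ := G.map_id i
        rw [hF, hG, Category.id_comp, Category.comp_id]
      · rw [map_homOfLE_add_one F hij, map_homOfLE_add_one G hij, Category.assoc, h,
          ← Category.assoc, ih, Category.assoc]
    exact key j (leOfHom a)

end Functor

/-! ### Construction of a pretriangle row by row -/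

section Rows

variable {C : Type u} [Category.{v} C]

/-- The functor `F`, thought of as row number `α` of a diagram on the strip, is zero outside of
the interior of the strip. -/
def IsRow (n : ℕ) (α : ℤ) (F : ℤ ⥤ C) : Prop :=
  ∀ β, β ≤ α ∨ α + n + 1 ≤ β → IsZero (F.obj β)

/-- The transformation `τ` from row number `α` to row number `α + 1` consists of exact squares
inside the strip: those between the columns `β` and `β + 1` for which `(α + 1, β)` and `(α, β + 1)`
are points of the strip. -/
def IsRowStep (n : ℕ) (α : ℤ) {F G : ℤ ⥤ C} (τ : F ⟶ G) : Prop :=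
  ∀ β, α + 1 ≤ β → β ≤ α + n →
    IsExactSquare (F.map (intStep β)) (τ.app β) (τ.app (β + 1)) (G.map (intStep β))

lemma exactSquare_of_rowSteps {n : ℕ} {Φ : ℤ ⥤ ℤ ⥤ C}
    (hΦ : ∀ α, IsRowStep n α (Φ.map (intStep α))) {α β γ δ : ℤ} (hαβ : α ≤ β) (hβγ : β ≤ γ)
    (hγδ : γ ≤ δ) (hδα : δ ≤ α + n + 1) :
    IsExactSquare ((Φ.obj α).map (homOfLE hγδ)) ((Φ.map (homOfLE hαβ)).app γ)
      ((Φ.map (homOfLE hαβ)).app δ) ((Φ.obj β).map (homOfLE hγδ)) := by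
  -- paste horizontally to obtain the squares between neighbouring rows
  have row : ∀ α γ : ℤ, α + 1 ≤ γ → ∀ (δ : ℤ) (hγδ : γ ≤ δ), δ ≤ α + n + 1 →
      IsExactSquare ((Φ.obj α).map (homOfLE hγδ)) ((Φ.map (intStep α)).app γ)
        ((Φ.map (intStep α)).app δ) ((Φ.obj (α + 1)).map (homOfLE hγδ)) := by
    intro α γ hα
    refine Int.leInduction (fun _ => ?_) fun δ hγδ ih hδ => ?_
    · have h : ∀ F : ℤ ⥤ C, F.map (homOfLE (le_refl γ)) = 𝟙 _ := fun F => F.map_id γ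
      rw [h, h]
      exact isExactSquare_id _
    · rw [map_homOfLE_add_one _ hγδ, map_homOfLE_add_one _ hγδ]
      exact (ih (by lia)).paste (hΦ α δ (by lia) (by lia))
  suffices key : ∀ β (hαβ : α ≤ β), β ≤ γ →
      IsExactSquare ((Φ.obj α).map (homOfLE hγδ)) ((Φ.map (homOfLE hαβ)).app γ)
        ((Φ.map (homOfLE hαβ)).app δ) ((Φ.obj β).map (homOfLE hγδ)) from key β hαβ hβγ
  refine Int.leInduction (fun _ => ?_) fun β hαβ ih hβ => ?_
  · have h : Φ.map (homOfLE (le_refl α)) = 𝟙 _ := Φ.map_id α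
    rw [h]
    exact (isExactSquare_id _).flip
  · rw [map_homOfLE_add_one _ hαβ, NatTrans.comp_app, NatTrans.comp_app]
    exact ((ih (by lia)).flip.paste (row β γ (by lia) δ hγδ (by lia)).flip).flip

/-- The diagram on the strip cut out of a diagram on `ℤ × ℤ` that is given by its rows. -/
def stripOfRows (n : ℕ) (Φ : ℤ ⥤ ℤ ⥤ C) : Strip n ⥤ C where
  obj p := (Φ.obj p.1.1).obj p.1.2
  map {p q} a := (Φ.map (homOfLE (leOfHom a).1)).app p.1.2 ≫
    (Φ.obj q.1.1).map (homOfLE (leOfHom a).2)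
  map_id p := by
    have h₁ : Φ.map (homOfLE (le_refl p.1.1)) = 𝟙 _ := Φ.map_id _
    have h₂ : (Φ.obj p.1.1).map (homOfLE (le_refl p.1.2)) = 𝟙 _ := (Φ.obj _).map_id _
    rw [h₁, h₂]
    simp
  map_comp {p q r} a b := by
    have h₁ : Φ.map (homOfLE ((leOfHom a).1.trans (leOfHom b).1)) =
        Φ.map (homOfLE (leOfHom a).1) ≫ Φ.map (homOfLE (leOfHom b).1) := by
      rw [← Φ.map_comp]; rfl
    have h₂ : (Φ.obj r.1.1).map (homOfLE ((leOfHom a).2.trans (leOfHom b).2)) =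
        (Φ.obj r.1.1).map (homOfLE (leOfHom a).2) ≫
          (Φ.obj r.1.1).map (homOfLE (leOfHom b).2) := by
      rw [← Functor.map_comp]; rfl
    rw [h₁, h₂, NatTrans.comp_app, Category.assoc, Category.assoc]
    congr 1
    rw [← NatTrans.naturality_assoc]

lemma isPretriangle_stripOfRows [Preadditive C] [HasBinaryBiproducts C] {n : ℕ}
    {Φ : ℤ ⥤ ℤ ⥤ C} (hΦ : ∀ α, IsRow n α (Φ.obj α))
    (hΦ' : ∀ α, IsRowStep n α (Φ.map (intStep α))) : IsPretriangle C n (stripOfRows n Φ) where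
  isZero_diag α := hΦ α α (Or.inl le_rfl)
  isZero_shift α := hΦ α _ (Or.inr (by unfold shift; lia))
  isWeakSquare α β γ δ hαβ hβγ hγδ hδα := by
    have h := exactSquare_of_rowSteps hΦ' hαβ hβγ hγδ (by unfold shift at hδα; lia)
    have hr : ∀ α γ δ (h : γ ≤ δ), (Φ.map (homOfLE (le_refl α))).app γ ≫
        (Φ.obj α).map (homOfLE h) = (Φ.obj α).map (homOfLE h) := fun α γ δ h => by
      have : Φ.map (homOfLE (le_refl α)) = 𝟙 _ := Φ.map_id _
      rw [this, NatTrans.id_app, Category.id_comp]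
    have hc : ∀ α β γ (h : α ≤ β), (Φ.map (homOfLE h)).app γ ≫
        (Φ.obj β).map (homOfLE (le_refl γ)) = (Φ.map (homOfLE h)).app γ := fun α β γ h => by
      have : (Φ.obj β).map (homOfLE (le_refl γ)) = 𝟙 _ := (Φ.obj β).map_id _
      rw [this, Category.comp_id]
    dsimp only [stripOfRows]
    rw [hr, hr, hc, hc]
    exact h.isWeakSquare

variable [Preadditive C] [HasBinaryBiproducts C] [HasZeroObject C] [WeaklyAbelian C]

open ZeroObject in
/-- The next row is built by weak pushouts, proceeding to the right from the zero object on the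
diagonal. -/
lemma exists_next_row (n : ℕ) (α : ℤ) (F : ℤ ⥤ C) (hF : IsRow n α F) :
    ∃ (G : ℤ ⥤ C) (τ : F ⟶ G), IsRow n (α + 1) G ∧ IsRowStep n α τ := by
  let S : ℤ → Type _ := fun β => { s : Σ G : C, F.obj β ⟶ G //
    (β ≤ α + 1 ∨ α + 1 + n + 1 ≤ β → IsZero s.1) }
  let z : ∀ β, S β := fun β => ⟨⟨0, 0⟩, fun _ => isZero_zero C⟩
  obtain ⟨s, -, hs⟩ := exists_int_sequence (S := S)
    (fun j k s s' => ∀ h : j + 1 = k, ∃ m : s.1.1 ⟶ s'.1.1,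
      F.map (homOfLE (show j ≤ k by lia)) ≫ s'.1.2 = s.1.2 ≫ m ∧
      (α + 1 ≤ j → j ≤ α + n →
        IsExactSquare (F.map (homOfLE (show j ≤ k by lia))) s.1.2 s'.1.2 m))
    (α + 1) (z _)
    (fun β hβ s => by
      by_cases hβ' : β ≤ α + n
      · obtain ⟨Y, y, m, h⟩ := exists_exactSquare_of_span (F.map (intStep β)) s.1.2
        exact ⟨⟨⟨Y, y⟩, fun h => by lia⟩, fun _ => ⟨m, h.w, fun _ _ => h⟩⟩
      · have h0 : IsZero (F.obj β) := hF β (by lia)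
        exact ⟨z _, fun _ => ⟨0, h0.eq_of_src _ _, fun _ _ => by lia⟩⟩)
    (fun β hβ s => ⟨z _, fun _ => ⟨0, (s.2 (Or.inl hβ)).eq_of_tgt _ _, fun _ _ => by lia⟩⟩)
  choose m hm hm' using fun k => hs k rfl
  refine ⟨functorOfSteps (X := fun k => (s k).1.1) m,
    natTransOfSteps (G := functorOfSteps (X := fun k => (s k).1.1) m) (fun k => (s k).1.2)
      (fun k => ?_), fun β h => (s β).2 h, fun β h h' => ?_⟩
  · rw [functorOfSteps_map_intStep]
    exact hm k
  · rw [functorOfSteps_map_intStep]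
    exact hm' β h h'

open ZeroObject in
/-- The previous row is built by weak pullbacks, proceeding to the left from the zero object on
the upper boundary. -/
lemma exists_previous_row (n : ℕ) (α : ℤ) (G : ℤ ⥤ C) (hG : IsRow n (α + 1) G) :
    ∃ (F : ℤ ⥤ C) (τ : F ⟶ G), IsRow n α F ∧ IsRowStep n α τ := by
  let S : ℤ → Type _ := fun β => { s : Σ F : C, F ⟶ G.obj β //
    (β ≤ α ∨ α + n + 1 ≤ β → IsZero s.1) }
  let z : ∀ β, S β := fun β => ⟨⟨0, 0⟩, fun _ => isZero_zero C⟩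
  obtain ⟨s, -, hs⟩ := exists_int_sequence (S := S)
    (fun j k s s' => ∀ h : j + 1 = k, ∃ m : s.1.1 ⟶ s'.1.1,
      m ≫ s'.1.2 = s.1.2 ≫ G.map (homOfLE (show j ≤ k by lia)) ∧
      (α + 1 ≤ j → j ≤ α + n →
        IsExactSquare m s.1.2 s'.1.2 (G.map (homOfLE (show j ≤ k by lia)))))
    (α + n + 1) (z _)
    (fun β hβ s => ⟨z _, fun _ => ⟨0, (s.2 (Or.inr hβ)).eq_of_src _ _, fun _ _ => by lia⟩⟩)
    (fun β hβ s => by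
      by_cases hβ' : α + 1 ≤ β - 1
      · obtain ⟨X, m, x, h⟩ := exists_exactSquare_of_cospan s.1.2
          (G.map (homOfLE (show β - 1 ≤ β by lia)))
        exact ⟨⟨⟨X, x⟩, fun h => by lia⟩, fun _ => ⟨m, h.w, fun _ _ => h⟩⟩
      · have h0 : IsZero (G.obj β) := hG β (by lia)
        exact ⟨z _, fun _ => ⟨0, h0.eq_of_tgt _ _, fun _ _ => by lia⟩⟩)
  choose m hm hm' using fun k => hs k rfl
  refine ⟨functorOfSteps (X := fun k => (s k).1.1) m,
    natTransOfSteps (F := functorOfSteps (X := fun k => (s k).1.1) m) (fun k => (s k).1.2)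
      (fun k => ?_), fun β h => (s β).2 h, fun β h h' => ?_⟩
  · rw [functorOfSteps_map_intStep]
    exact hm k
  · rw [functorOfSteps_map_intStep]
    exact hm' β h h'

/-- Every row with number zero is part of a diagram on `ℤ × ℤ` that is composed of exact squares
inside the strip and zero outside of its interior. -/
lemma exists_rows (n : ℕ) (F : ℤ ⥤ C) (hF : IsRow n 0 F) :
    ∃ Φ : ℤ ⥤ ℤ ⥤ C, Φ.obj 0 = F ∧ (∀ α, IsRow n α (Φ.obj α)) ∧
      ∀ α, IsRowStep n α (Φ.map (intStep α)) := by
  obtain ⟨s, hs₀, hs⟩ := exists_int_sequence (S := fun α => { F : ℤ ⥤ C // IsRow n α F })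
    (fun j k F G => ∃ τ : F.1 ⟶ G.1, IsRowStep n j τ) 0 ⟨F, hF⟩
    (fun α _ F => by
      obtain ⟨G, τ, hG, hτ⟩ := exists_next_row n α F.1 F.2
      exact ⟨⟨G, hG⟩, τ, hτ⟩)
    (fun α _ G => by
      obtain ⟨F, τ, hF, hτ⟩ := exists_previous_row n (α - 1) G.1 (by
        rw [sub_add_cancel]; exact G.2)
      exact ⟨⟨F, hF⟩, τ, hτ⟩)
  choose τ hτ using hs
  refine ⟨functorOfSteps (X := fun α => (s α).1) τ, congrArg Subtype.val hs₀,
    fun α => (s α).2, fun α => ?_⟩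
  rw [functorOfSteps_map_intStep]
  exact hτ α

end Rows

section Density

variable {C : Type u} [Category.{v} C] [HasZeroObject C]

/-- The inclusion of `{1 < ⋯ < n}` into `ℤ`. -/
abbrev dotToInt (n : ℕ) : DotDelta n ⥤ ℤ :=
  Monotone.functor (f := fun i : DotDelta n => i.1) (fun _ _ h => h)

/-- The membership of `k` in `{1 < ⋯ < n}`. -/
abbrev IsDot (n : ℕ) (k : ℤ) : Prop := k ∈ Set.Icc (1 : ℤ) n

open ZeroObject in
/-- The objects of the extension by zero of a diagram on `{1 < ⋯ < n}` to `ℤ`. -/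
def extendObj {n : ℕ} (X : DotDelta n ⥤ C) (k : ℤ) : C :=
  if h : IsDot n k then X.obj ⟨k, h⟩ else 0

lemma extendObj_of_isDot {n : ℕ} (X : DotDelta n ⥤ C) {k : ℤ} (h : IsDot n k) :
    extendObj X k = X.obj ⟨k, h⟩ := dif_pos h

lemma isZero_extendObj {n : ℕ} (X : DotDelta n ⥤ C) {k : ℤ} (h : ¬ IsDot n k) :
    IsZero (extendObj X k) := by
  rw [extendObj, dif_neg h]
  exact isZero_zero C

variable [Preadditive C]

/-- The morphisms of the extension by zero of a diagram on `{1 < ⋯ < n}` to `ℤ`. -/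
def extendMap {n : ℕ} (X : DotDelta n ⥤ C) {k l : ℤ} (a : k ⟶ l) :
    extendObj X k ⟶ extendObj X l :=
  if h : IsDot n k ∧ IsDot n l then
    eqToHom (extendObj_of_isDot X h.1) ≫
      X.map (homOfLE (show (⟨k, h.1⟩ : DotDelta n) ≤ ⟨l, h.2⟩ from leOfHom a)) ≫
      eqToHom (extendObj_of_isDot X h.2).symm
  else 0

lemma extendMap_of_isDot {n : ℕ} (X : DotDelta n ⥤ C) {k l : ℤ} (a : k ⟶ l) (hk : IsDot n k)
    (hl : IsDot n l) :
    extendMap X a = eqToHom (extendObj_of_isDot X hk) ≫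
      X.map (homOfLE (show (⟨k, hk⟩ : DotDelta n) ≤ ⟨l, hl⟩ from leOfHom a)) ≫
      eqToHom (extendObj_of_isDot X hl).symm :=
  dif_pos (And.intro hk hl)

/-- The extension by zero of a diagram on `{1 < ⋯ < n}` to `ℤ`. -/
def extendByZero {n : ℕ} (X : DotDelta n ⥤ C) : ℤ ⥤ C where
  obj := extendObj X
  map a := extendMap X a
  map_id k := by
    by_cases h : IsDot n k
    · have : X.map (homOfLE (le_refl (⟨k, h⟩ : DotDelta n))) = 𝟙 _ := X.map_id _
      rw [extendMap_of_isDot X _ h h, this]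
      simp
    · exact (isZero_extendObj X h).eq_of_src _ _
  map_comp {k l m} a b := by
    by_cases hk : IsDot n k
    · by_cases hm : IsDot n m
      · have hl : IsDot n l := ⟨hk.1.trans (leOfHom a), (leOfHom b).trans hm.2⟩
        rw [extendMap_of_isDot X _ hk hm, extendMap_of_isDot X _ hk hl,
          extendMap_of_isDot X _ hl hm]
        simp only [Category.assoc, eqToHom_trans_assoc, eqToHom_refl, Category.id_comp]
        rw [← X.map_comp_assoc]
        rfl
      · exact (isZero_extendObj X hm).eq_of_tgt _ _
    · exact (isZero_extendObj X hk).eq_of_src _ _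

lemma isRow_extendByZero {n : ℕ} (X : DotDelta n ⥤ C) : IsRow n 0 (extendByZero X) :=
  fun _ hk => isZero_extendObj X fun h => by
    have := h.1
    have := h.2
    lia

lemma extendMap_comp_eqToHom {n : ℕ} (X : DotDelta n ⥤ C) {i j : DotDelta n} (a : i ⟶ j) :
    extendMap X (homOfLE (show i.1 ≤ j.1 from leOfHom a)) ≫ eqToHom (extendObj_of_isDot X j.2) =
      eqToHom (extendObj_of_isDot X i.2) ≫ X.map a := by
  rw [extendMap_of_isDot X _ i.2 j.2]
  simp only [Category.assoc, eqToHom_trans, eqToHom_refl, Category.comp_id]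
  rfl

/-- The extension by zero is an extension. -/
def dotToIntCompExtendByZero {n : ℕ} (X : DotDelta n ⥤ C) :
    dotToInt n ⋙ extendByZero X ≅ X :=
  NatIso.ofComponents (fun i => (eqToIso (extendObj_of_isDot X i.2) : extendObj X i.1 ≅ X.obj i))
    (extendMap_comp_eqToHom X)

variable [HasBinaryBiproducts C] [WeaklyAbelian C]

lemma exists_pretriangle_of_row {n : ℕ} (F : ℤ ⥤ C) (hF : IsRow n 0 F) :
    ∃ Z : Pretriangle C n, Nonempty ((restriction C n).obj Z ≅ dotToInt n ⋙ F) := by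
  obtain ⟨Φ, rfl, hΦ, hΦ'⟩ := exists_rows n F hF
  refine ⟨⟨stripOfRows n Φ, isPretriangle_stripOfRows hΦ hΦ'⟩,
    ⟨NatIso.ofComponents (fun i => Iso.refl _) ?_⟩⟩
  intro i j a
  have h : Φ.map (homOfLE (le_refl (0 : ℤ))) = 𝟙 _ := Φ.map_id 0
  have h' : ((restriction C n).obj ⟨stripOfRows n Φ, isPretriangle_stripOfRows hΦ hΦ'⟩).map a =
      (Φ.map (homOfLE (le_refl (0 : ℤ)))).app i.1 ≫
        (Φ.obj 0).map (homOfLE (show i.1 ≤ j.1 from leOfHom a)) := rfl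
  rw [h', h]
  exact (Category.comp_id _).trans rfl

variable (C) in
instance (n : ℕ) : (restriction C n).EssSurj where
  mem_essImage X := by
    obtain ⟨Z, ⟨e⟩⟩ := exists_pretriangle_of_row (extendByZero X) (isRow_extendByZero X)
    exact ⟨Z, ⟨e ≪≫ dotToIntCompExtendByZero X⟩⟩

end Density

/-! ### Split pretriangles that are free on a family of objects -/

section Free

variable {n : ℕ}

/-- The point `q` of the strip lies in the rectangle that starts at `p`: it is above `p`, and the
morphism from `p` to `q` passes neither through the diagonal nor through the upper boundary. -/
structure Reaches (p q : Strip n) : Prop where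
  le : p ≤ q
  fst_lt : q.1.1 < p.1.2
  snd_lt : q.1.2 < p.1.1 + n + 1

lemma reaches_iff {p q : Strip n} : Reaches p q ↔ (p.1.1 ≤ q.1.1 ∧ p.1.2 ≤ q.1.2) ∧
    q.1.1 < p.1.2 ∧ q.1.2 < p.1.1 + n + 1 :=
  ⟨fun h => ⟨h.le, h.fst_lt, h.snd_lt⟩, fun h => ⟨h.1, h.2.1, h.2.2⟩⟩

lemma Reaches.convex {p q r s : Strip n} (hq : Reaches p q) (hqr : q ≤ r) (hrs : r ≤ s)
    (hs : Reaches p s) : Reaches p r :=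
  ⟨hq.le.trans hqr, hrs.1.trans_lt hs.fst_lt, hrs.2.trans_lt hs.snd_lt⟩

instance (q : Strip n) : Finite {p : Strip n // Reaches p q} := by
  refine Finite.of_injective (β := Set.Icc ((q.1.2 - n - 1, q.1.1) : ℤ × ℤ) (q.1.1, q.1.2))
    (fun p => ⟨p.1.1, ⟨?_, ?_⟩, ⟨?_, ?_⟩⟩) fun p p' h => ?_
  · have := p.2.snd_lt
    change q.1.2 - n - 1 ≤ p.1.1.1
    lia
  · exact p.2.fst_lt.le
  · exact p.2.le.1
  · exact p.2.le.2
  · have h' := Subtype.ext_iff.1 h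
    exact Subtype.ext (Subtype.ext h')

variable {C : Type u} [Category.{v} C] [Preadditive C] [HasFiniteBiproducts C]

/-- The object at `q` of the free diagram on the family `A`. -/
abbrev freeObj (A : Strip n → C) (q : Strip n) : C :=
  ⨁ fun p : {p : Strip n // Reaches p q} => A p.1

open Classical in
/-- The morphism that is the identity on common summands, and zero otherwise. -/
def freeMap (A : Strip n → C) (q q' : Strip n) : freeObj A q ⟶ freeObj A q' :=
  biproduct.desc fun p =>
    if h : Reaches p.1 q' then
      biproduct.ι (fun p : {p : Strip n // Reaches p q'} => A p.1) ⟨p.1, h⟩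
    else 0

/-- The inclusion of the summand of index `p` of `freeObj A q`. -/
abbrev freeι (A : Strip n → C) {p q : Strip n} (h : Reaches p q) : A p ⟶ freeObj A q :=
  biproduct.ι (fun p : {p : Strip n // Reaches p q} => A p.1) ⟨p, h⟩

/-- The projection to the summand of index `p` of `freeObj A q`. -/
abbrev freeπ (A : Strip n → C) {p q : Strip n} (h : Reaches p q) : freeObj A q ⟶ A p :=
  biproduct.π (fun p : {p : Strip n // Reaches p q} => A p.1) ⟨p, h⟩

variable (A : Strip n → C)

lemma freeObj_hom_ext {q : Strip n} {T : C} {f g : freeObj A q ⟶ T}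
    (h : ∀ p (hp : Reaches p q), freeι A hp ≫ f = freeι A hp ≫ g) : f = g :=
  biproduct.hom_ext' _ _ fun p => h p.1 p.2

lemma freeObj_hom_ext' {q : Strip n} {T : C} {f g : T ⟶ freeObj A q}
    (h : ∀ p (hp : Reaches p q), f ≫ freeπ A hp = g ≫ freeπ A hp) : f = g :=
  biproduct.hom_ext _ _ fun p => h p.1 p.2

lemma freeι_freeMap {p q q' : Strip n} (h : Reaches p q) (h' : Reaches p q') :
    freeι A h ≫ freeMap A q q' = freeι A h' := by
  rw [freeMap, biproduct.ι_desc, dif_pos h']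

lemma freeι_freeMap_eq_zero {p q q' : Strip n} (h : Reaches p q) (h' : ¬ Reaches p q') :
    freeι A h ≫ freeMap A q q' = 0 := by
  rw [freeMap, biproduct.ι_desc, dif_neg h']

lemma freeι_freeπ {p q : Strip n} (h : Reaches p q) : freeι A h ≫ freeπ A h = 𝟙 _ :=
  biproduct.ι_π_self _ _

lemma freeι_freeπ_of_ne {p p' q : Strip n} (h : Reaches p q) (h' : Reaches p' q) (hp : p ≠ p') :
    freeι A h ≫ freeπ A h' = 0 :=
  biproduct.ι_π_ne _ fun e => hp (congrArg Subtype.val e)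

lemma freeMap_freeπ {p q q' : Strip n} (h : Reaches p q) (h' : Reaches p q') :
    freeMap A q q' ≫ freeπ A h' = freeπ A h := by
  refine freeObj_hom_ext A fun r hr => ?_
  by_cases hrp : r = p
  · subst hrp
    rw [← Category.assoc, freeι_freeMap A hr h', freeι_freeπ, freeι_freeπ]
  · rw [← Category.assoc, freeι_freeπ_of_ne A hr h hrp]
    by_cases hr' : Reaches r q'
    · rw [freeι_freeMap A hr hr', freeι_freeπ_of_ne A hr' h' hrp]
    · rw [freeι_freeMap_eq_zero A hr hr', zero_comp]

lemma freeMap_freeπ_eq_zero {p q q' : Strip n} (h : ¬ Reaches p q) (h' : Reaches p q') :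
    freeMap A q q' ≫ freeπ A h' = 0 := by
  refine freeObj_hom_ext A fun r hr => ?_
  have hrp : r ≠ p := by rintro rfl; exact h hr
  rw [← Category.assoc, comp_zero]
  by_cases hr' : Reaches r q'
  · rw [freeι_freeMap A hr hr', freeι_freeπ_of_ne A hr' h' hrp]
  · rw [freeι_freeMap_eq_zero A hr hr', zero_comp]

lemma freeMap_comp {q r s : Strip n} (h : ∀ p, Reaches p q → Reaches p s → Reaches p r) :
    freeMap A q r ≫ freeMap A r s = freeMap A q s := by
  refine freeObj_hom_ext A fun p hp => ?_
  rw [← Category.assoc]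
  by_cases hr : Reaches p r
  · rw [freeι_freeMap A hp hr]
    by_cases hs : Reaches p s
    · rw [freeι_freeMap A hr hs, freeι_freeMap A hp hs]
    · rw [freeι_freeMap_eq_zero A hr hs, freeι_freeMap_eq_zero A hp hs]
  · rw [freeι_freeMap_eq_zero A hp hr, zero_comp, freeι_freeMap_eq_zero A hp fun hs => hr (h p hp hs)]

lemma freeMap_self (q : Strip n) : freeMap A q q = 𝟙 _ :=
  freeObj_hom_ext A fun p hp => by rw [freeι_freeMap A hp hp, Category.comp_id]

/-- The free diagram on the family `A`: the direct sum, over the points `p` of the strip, of the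
diagrams with constant value `A p` on the rectangle that starts at `p` and zero elsewhere. -/
def freeDiagram : Strip n ⥤ C where
  obj := freeObj A
  map {q r} _ := freeMap A q r
  map_id q := freeMap_self A q
  map_comp a b := (freeMap_comp A fun _ h h' => h.convex (leOfHom a) (leOfHom b) h').symm

lemma isRegular_freeDiagram_map {q r : Strip n} (a : q ⟶ r) :
    IsRegular ((freeDiagram A).map a) := by
  refine ⟨freeMap A r q, ?_⟩
  change freeMap A q r ≫ freeMap A r q ≫ freeMap A q r = freeMap A q r
  refine freeObj_hom_ext A fun p hp => ?_
  by_cases hr : Reaches p r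
  · rw [← Category.assoc, ← Category.assoc, freeι_freeMap A hp hr, freeι_freeMap A hr hp,
      freeι_freeMap A hp hr]
  · rw [← Category.assoc, freeι_freeMap_eq_zero A hp hr, zero_comp]

variable {A} in
lemma isZero_freeObj {q : Strip n} (h : ∀ p, ¬ Reaches p q) : IsZero (freeObj A q) := by
  rw [IsZero.iff_id_eq_zero]
  exact freeObj_hom_ext A fun p hp => (h p hp).elim

/-- The weak square condition for rectangles: the exactness can be read off in each summand. -/
lemma isWeakSquare_freeMap [HasBinaryBiproducts C] {q r q' r' : Strip n}
    (h₁ : ∀ p, Reaches p r → Reaches p q' → Reaches p q ∧ Reaches p r')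
    (h₂ : ∀ p, Reaches p r → ¬ Reaches p q → Reaches p r')
    (h₃ : ∀ p, Reaches p q' → ¬ Reaches p q → Reaches p r')
    (h₄ : ∀ p, Reaches p q → Reaches p r' → Reaches p r ∧ Reaches p q') :
    IsWeakSquare (freeMap A q r) (freeMap A q q') (freeMap A r r') (freeMap A q' r') := by
  classical
  rw [isWeakSquare_iff_weakPullback]
  refine ⟨?_, fun T a b hab => ?_⟩
  · rw [freeMap_comp A (fun p h h' => (h₄ p h h').1), freeMap_comp A (fun p h h' => (h₄ p h h').2)]
  · have hab' : ∀ p (h : Reaches p q') (h' : Reaches p r),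
        a ≫ freeπ A h = b ≫ freeπ A h' := fun p h h' => by
      have hr := (h₁ p h' h).2
      have := congr($hab ≫ freeπ A hr)
      rwa [Category.assoc, Category.assoc, freeMap_freeπ A h hr, freeMap_freeπ A h' hr] at this
    have ha : ∀ p (h : Reaches p q'), ¬ Reaches p q → a ≫ freeπ A h = 0 := fun p h h' => by
      have hr := h₃ p h h'
      have := congr($hab ≫ freeπ A hr)
      rwa [Category.assoc, Category.assoc, freeMap_freeπ A h hr,
        freeMap_freeπ_eq_zero A (fun hr => h' (h₁ p hr h).1) hr, comp_zero] at this
    have hb : ∀ p (h : Reaches p r), ¬ Reaches p q → b ≫ freeπ A h = 0 := fun p h h' => by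
      have hr := h₂ p h h'
      have := congr($hab ≫ freeπ A hr)
      rw [Category.assoc, Category.assoc, freeMap_freeπ A h hr,
        freeMap_freeπ_eq_zero A (fun hq => h' (h₁ p h hq).1) hr, comp_zero] at this
      exact this.symm
    let t : T ⟶ freeObj A q := biproduct.lift fun p =>
      if h : Reaches p.1 q' then a ≫ freeπ A h
      else if h' : Reaches p.1 r then b ≫ freeπ A h' else 0
    have ht : ∀ p (hp : Reaches p q), t ≫ freeπ A hp = if h : Reaches p q' then a ≫ freeπ A h
        else if h' : Reaches p r then b ≫ freeπ A h' else 0 :=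
      fun p hp => biproduct.lift_π _ _
    refine ⟨t, freeObj_hom_ext' A fun p hp => ?_, freeObj_hom_ext' A fun p hp => ?_⟩
    · rw [Category.assoc]
      by_cases h : Reaches p q
      · rw [freeMap_freeπ A h hp, ht, dif_pos hp]
      · rw [freeMap_freeπ_eq_zero A h hp, comp_zero, ha p hp h]
    · rw [Category.assoc]
      by_cases h : Reaches p q
      · rw [freeMap_freeπ A h hp, ht]
        by_cases h' : Reaches p q'
        · rw [dif_pos h', hab' p h' hp]
        · rw [dif_neg h', dif_pos hp]
      · rw [freeMap_freeπ_eq_zero A h hp, comp_zero, hb p hp h]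

lemma isPretriangle_freeDiagram [HasBinaryBiproducts C] : IsPretriangle C n (freeDiagram A) where
  isZero_diag α := isZero_freeObj fun p hp => by
    have h₁ := hp.le.2
    have h₂ := hp.fst_lt
    dsimp only at h₁ h₂
    lia
  isZero_shift α := isZero_freeObj fun p hp => by
    have h₁ := hp.le.1
    have h₂ := hp.snd_lt
    dsimp only [shift] at h₁ h₂
    lia
  isWeakSquare α β γ δ hαβ hβγ hγδ hδα := by
    unfold shift at hδα
    refine isWeakSquare_freeMap A ?_ ?_ ?_ ?_ <;> intro p <;>
      simp only [reaches_iff] <;> lia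

/-- The morphism from the free diagram on the objects of `Y` to `Y`. -/
def freeCounit {Y : Strip n ⥤ C} (hY : ∀ p : Strip n, (p.1.2 = p.1.1 ∨ p.1.2 = p.1.1 + n + 1) →
    IsZero (Y.obj p)) : freeDiagram Y.obj ⟶ Y where
  app q := biproduct.desc fun p => Y.map (homOfLE p.2.le)
  naturality q r a := by
    refine freeObj_hom_ext Y.obj fun p hp => ?_
    change freeι Y.obj hp ≫ freeMap Y.obj q r ≫ _ = freeι Y.obj hp ≫ _ ≫ Y.map a
    rw [← Category.assoc, ← Category.assoc, biproduct.ι_desc]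
    by_cases hr : Reaches p r
    · rw [freeι_freeMap Y.obj hp hr, biproduct.ι_desc, ← Y.map_comp]
      rfl
    · rw [freeι_freeMap_eq_zero Y.obj hp hr, zero_comp, ← Y.map_comp]
      -- outside of the rectangle, the morphism from `p` factors over a zero object
      have hpr : p ≤ r := hp.le.trans (leOfHom a)
      by_cases h : r.1.1 < p.1.2
      · have h' : p.1.1 + n + 1 ≤ r.1.2 := by
          by_contra h'
          exact hr ⟨hpr, h, by lia⟩
        let z : Strip n := ⟨(p.1.1, p.1.1 + n + 1), by dsimp only [shift]; lia⟩
        have hpz : p ≤ z := ⟨le_rfl, by have := p.2.2; dsimp only [shift] at this ⊢; lia⟩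
        have hzr : z ≤ r := ⟨hpr.1, h'⟩
        have : homOfLE hp.le ≫ a = homOfLE hpz ≫ homOfLE hzr := rfl
        rw [this, Y.map_comp, (hY z (Or.inr rfl)).eq_of_tgt (Y.map (homOfLE hpz)) 0, zero_comp]
      · let z : Strip n := ⟨(p.1.2, p.1.2), by dsimp only [shift]; lia⟩
        have hpz : p ≤ z := ⟨p.2.1, le_rfl⟩
        have hzr : z ≤ r := ⟨not_lt.1 h, hpr.2⟩
        have : homOfLE hp.le ≫ a = homOfLE hpz ≫ homOfLE hzr := rfl
        rw [this, Y.map_comp, (hY z (Or.inl rfl)).eq_of_tgt (Y.map (homOfLE hpz)) 0, zero_comp]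

lemma exists_section_freeCounit {Y : Strip n ⥤ C}
    (hY : ∀ p : Strip n, (p.1.2 = p.1.1 ∨ p.1.2 = p.1.1 + n + 1) → IsZero (Y.obj p))
    (q : Strip n) : ∃ i : Y.obj q ⟶ (freeDiagram Y.obj).obj q,
      i ≫ (freeCounit hY).app q = 𝟙 _ := by
  by_cases hq : q.1.2 = q.1.1 ∨ q.1.2 = q.1.1 + n + 1
  · exact ⟨0, (hY q hq).eq_of_src _ _⟩
  · have h₁ := q.2.1
    have h₂ := q.2.2
    dsimp only [shift] at h₂
    have h : Reaches q q := ⟨le_rfl, by lia, by lia⟩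
    exact ⟨freeι Y.obj h, (biproduct.ι_desc _ _).trans (Y.map_id q)⟩

end Free

/-! ### Lifting morphisms of pretriangles -/

/-- Recursion along a measure, where the value at a point has to satisfy a condition that involves
the previous values. -/
lemma exists_of_measure {P : Type*} {T : P → Type*} [∀ p, Nonempty (T p)] (μ : P → ℕ)
    (Q : ∀ p, (∀ q, μ q < μ p → T q) → T p → Prop)
    (step : ∀ p (f : ∀ q, μ q < μ p → T q),
      (∀ q (hq : μ q < μ p), Q q (fun r hr => f r (hr.trans hq)) (f q hq)) → ∃ v, Q p f v) :
    ∃ t : ∀ p, T p, ∀ p, Q p (fun q _ => t q) (t p) := by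
  classical
  have wf : WellFounded fun p q : P => μ p < μ q := (measure μ).wf
  let t : ∀ p, T p := wf.fix fun p f =>
    if h : ∃ v, Q p f v then h.choose else Classical.arbitrary _
  have ht : ∀ p, t p = if h : ∃ v, Q p (fun q _ => t q) v then h.choose
      else Classical.arbitrary _ := fun p => wf.fix_eq _ p
  refine ⟨t, fun p => ?_⟩
  induction p using wf.induction with
  | _ p ih =>
    have h := step p (fun q _ => t q) ih
    rw [ht p, dif_pos h]
    exact h.choose_spec

section Lifting

variable {C : Type u} [Category.{v} C] [Preadditive C] [HasBinaryBiproducts C] {n : ℕ}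

lemma IsPretriangle.isZero {X : Strip n ⥤ C} (hX : IsPretriangle C n X) (p : Strip n)
    (hp : p.1.2 = p.1.1 ∨ p.1.2 = p.1.1 + n + 1) : IsZero (X.obj p) := by
  obtain ⟨⟨α, β⟩, h⟩ := p
  dsimp only at hp
  rcases hp with rfl | rfl
  · exact hX.isZero_diag _
  · simpa only [shift, add_assoc] using hX.isZero_shift α

/-- The morphism from a point `p` to a point above it is zero if it passes through the boundary. -/
lemma IsPretriangle.map_eq_zero {X : Strip n ⥤ C} (hX : IsPretriangle C n X) {p q r : Strip n}
    (hpq : p ≤ q) (hqr : q ≤ r) (hq : q.1.2 = q.1.1 ∨ q.1.2 = q.1.1 + n + 1) :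
    X.map (homOfLE (hpq.trans hqr)) = 0 := by
  have : homOfLE (hpq.trans hqr) = homOfLE hpq ≫ homOfLE hqr := rfl
  rw [this, X.map_comp, (hX.isZero q hq).eq_of_tgt (X.map (homOfLE hpq)) 0, zero_comp]

lemma IsPretriangle.weakSquare {X : Strip n ⥤ C} (hX : IsPretriangle C n X)
    {p q p' q' : Strip n} (h₁ : p.1.1 = q.1.1) (h₂ : p'.1.1 = q'.1.1) (h₃ : p.1.2 = p'.1.2)
    (h₄ : q.1.2 = q'.1.2) (h : p'.1.1 ≤ p.1.2) (hpq : p ≤ q) (hpp' : p ≤ p') (hqq' : q ≤ q')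
    (hpq' : p' ≤ q') :
    IsWeakSquare (X.map (homOfLE hpq)) (X.map (homOfLE hpp'))
      (X.map (homOfLE hqq')) (X.map (homOfLE hpq')) := by
  obtain ⟨⟨α, γ⟩, hp⟩ := p
  obtain ⟨⟨α', δ⟩, hq⟩ := q
  obtain ⟨⟨β, γ'⟩, hp'⟩ := p'
  obtain ⟨⟨β', δ'⟩, hq'⟩ := q'
  dsimp only at h₁ h₂ h₃ h₄ h
  subst h₁ h₂ h₃ h₄
  exact hX.isWeakSquare α β γ δ hpp'.1 h hpq.2 hq.2

/-- A morphism to `Y.obj q` that vanishes in `r`, to the right of `q`, and in `s`, below `q`, can be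
lifted along a pointwise split epimorphism without losing this property. Indeed, by exactness, it
comes from `Y.obj b` for a point `b` such that the morphisms from `b` to `r` and from `b` to `s` pass
through the boundary of the strip. -/
lemma exists_lift_of_comp_eq_zero {W Y : Strip n ⥤ C} (hW : IsPretriangle C n W)
    (hY : IsPretriangle C n Y) {π : W ⟶ Y}
    (hπ : ∀ p, ∃ i : Y.obj p ⟶ W.obj p, i ≫ π.app p = 𝟙 _) {q r s : Strip n}
    (hqr : q ≤ r) (hqs : q ≤ s) (hr : q.1.1 = r.1.1) (hs : q.1.2 = s.1.2) {T : C}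
    (v : T ⟶ Y.obj q) (hvr : v ≫ Y.map (homOfLE hqr) = 0) (hvs : v ≫ Y.map (homOfLE hqs) = 0) :
    ∃ v' : T ⟶ W.obj q, v' ≫ π.app q = v ∧ v' ≫ W.map (homOfLE hqr) = 0 ∧
      v' ≫ W.map (homOfLE hqs) = 0 := by
  have hq₁ := q.2.1
  have hr₂ := r.2.2
  have hs₁ := s.2.1
  have hqs₁ := hqs.1
  have hqr₂ := hqr.2
  dsimp only [shift] at hr₂
  -- `z` and `d` are boundary points in the row of `b` and in the column of `b`, respectively
  let m : Strip n := ⟨(r.1.2 - n - 1, q.1.2), by dsimp only [shift]; lia⟩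
  let z : Strip n := ⟨(r.1.2 - n - 1, r.1.2), by dsimp only [shift]; lia⟩
  let d : Strip n := ⟨(s.1.1, s.1.1), by dsimp only [shift]; lia⟩
  let b : Strip n := ⟨(r.1.2 - n - 1, s.1.1), by dsimp only [shift]; lia⟩
  have hz : z.1.2 = z.1.1 ∨ z.1.2 = z.1.1 + n + 1 :=
    Or.inr (show r.1.2 = r.1.2 - n - 1 + n + 1 by lia)
  have hbm : b ≤ m := ⟨le_rfl, show s.1.1 ≤ q.1.2 by lia⟩
  have hbd : b ≤ d := ⟨show r.1.2 - n - 1 ≤ s.1.1 by lia, le_rfl⟩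
  have hds : d ≤ s := ⟨le_rfl, show s.1.1 ≤ s.1.2 by lia⟩
  have hmq : m ≤ q := ⟨show r.1.2 - n - 1 ≤ q.1.1 by lia, le_rfl⟩
  have hmz : m ≤ z := ⟨le_rfl, show q.1.2 ≤ r.1.2 by lia⟩
  have hzr : z ≤ r := ⟨show r.1.2 - n - 1 ≤ r.1.1 by lia, le_rfl⟩
  obtain ⟨-, h₁⟩ := (isWeakSquare_iff_weakPullback _ _ _ _).1
    (hY.weakSquare (p := m) (q := z) (p' := q) (q' := r) rfl hr rfl rfl hq₁ hmz hmq hzr hqr)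
  obtain ⟨-, h₂⟩ := (isWeakSquare_iff_weakPullback _ _ _ _).1
    (hY.weakSquare (p := b) (q := m) (p' := d) (q' := s) rfl rfl rfl hs le_rfl hbm hbd
      (hmq.trans hqs) hds)
  obtain ⟨t, ht, -⟩ := h₁ v 0 (by rw [hvr, zero_comp])
  obtain ⟨t', -, ht'⟩ := h₂ 0 t (by
    have : homOfLE (hmq.trans hqs) = homOfLE hmq ≫ homOfLE hqs := rfl
    rw [this, Y.map_comp, ← Category.assoc, ht, hvs, zero_comp])
  obtain ⟨i, hi⟩ := hπ b
  refine ⟨t' ≫ i ≫ W.map (homOfLE (hbm.trans hmq)), ?_, ?_, ?_⟩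
  · have : homOfLE (hbm.trans hmq) = homOfLE hbm ≫ homOfLE hmq := rfl
    rw [Category.assoc, Category.assoc, π.naturality, reassoc_of% hi, this, Y.map_comp,
      ← Category.assoc, ht', ht]
  · rw [Category.assoc, Category.assoc, ← W.map_comp]
    have := hW.map_eq_zero (hbm.trans hmz) hzr hz
    rw [show homOfLE (hbm.trans hmq) ≫ homOfLE hqr = homOfLE ((hbm.trans hmz).trans hzr) from rfl,
      this, comp_zero, comp_zero]
  · rw [Category.assoc, Category.assoc, ← W.map_comp]
    have := hW.map_eq_zero hbd hds (Or.inl rfl)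
    rw [show homOfLE (hbm.trans hmq) ≫ homOfLE hqs = homOfLE (hbd.trans hds) from rfl,
      this, comp_zero, comp_zero]

variable [HasZeroObject C] [WeaklyAbelian C]

lemma IsPretriangle.exactSquare {X : Strip n ⥤ C} (hX : IsPretriangle C n X)
    {p q p' q' : Strip n} (h₁ : p.1.1 = q.1.1) (h₂ : p'.1.1 = q'.1.1) (h₃ : p.1.2 = p'.1.2)
    (h₄ : q.1.2 = q'.1.2) (h : p'.1.1 ≤ p.1.2) (hpq : p ≤ q) (hpp' : p ≤ p') (hqq' : q ≤ q')
    (hpq' : p' ≤ q') :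
    IsExactSquare (X.map (homOfLE hpq)) (X.map (homOfLE hpp'))
      (X.map (homOfLE hqq')) (X.map (homOfLE hpq')) :=
  (hX.weakSquare h₁ h₂ h₃ h₄ h hpq hpp' hqq' hpq').isExactSquare

/-- A lift that is given in row zero extends to the rows with positive number. In each point, a weak
pushout yields a morphism compatible with the previous ones. The defect of its composite with `π`
vanishes in the previous points, so it can be corrected by means of a section of `π` in this point. -/
lemma exists_lift_nonneg {X W Y : Strip n ⥤ C} (hX : IsPretriangle C n X)
    (hW : IsPretriangle C n W) {π : W ⟶ Y}
    (hπ : ∀ p, ∃ i : Y.obj p ⟶ W.obj p, i ≫ π.app p = 𝟙 _) (g : X ⟶ Y)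
    (s₀ : ∀ p : Strip n, p.1.1 = 0 → (X.obj p ⟶ W.obj p))
    (hs₀ : ∀ (p q : Strip n) (hp : p.1.1 = 0) (hq : q.1.1 = 0) (h : p ≤ q),
      X.map (homOfLE h) ≫ s₀ q hq = s₀ p hp ≫ W.map (homOfLE h))
    (hs₀' : ∀ (p : Strip n) (hp : p.1.1 = 0), s₀ p hp ≫ π.app p = g.app p) :
    ∃ s : ∀ p : Strip n, X.obj p ⟶ W.obj p, (∀ p hp, s p = s₀ p hp) ∧
      (∀ p : Strip n, 0 ≤ p.1.1 → s p ≫ π.app p = g.app p) ∧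
      ∀ p q : Strip n, 0 ≤ p.1.1 → ∀ h : p ≤ q,
        X.map (homOfLE h) ≫ s q = s p ≫ W.map (homOfLE h) := by
  let μ : Strip n → ℕ := fun p => (p.1.1 + p.1.2).toNat
  have hμ : ∀ {p q : Strip n}, 0 ≤ p.1.1 → p ≤ q → p = q ∨ μ p < μ q := by
    intro p q hp hpq
    by_cases h : p.1.1 = q.1.1 ∧ p.1.2 = q.1.2
    · exact Or.inl (Subtype.ext (Prod.ext h.1 h.2))
    · right
      have h₁ := hpq.1
      have h₂ := hpq.2
      have h₃ := p.2.1
      change (p.1.1 + p.1.2).toNat < (q.1.1 + q.1.2).toNat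
      omega
  let Q : ∀ p, (∀ q, μ q < μ p → (X.obj q ⟶ W.obj q)) → (X.obj p ⟶ W.obj p) → Prop :=
    fun p f v => (∀ hp, v = s₀ p hp) ∧ (0 ≤ p.1.1 → v ≫ π.app p = g.app p ∧
      ∀ (q : Strip n) (hqp : q ≤ p) (hq : μ q < μ p), 0 ≤ q.1.1 →
        X.map (homOfLE hqp) ≫ v = f q hq ≫ W.map (homOfLE hqp))
  have step : ∀ p f, (∀ q (hq : μ q < μ p), Q q (fun r hr => f r (hr.trans hq)) (f q hq)) →
      ∃ v, Q p f v := by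
    intro p f ih
    rcases lt_trichotomy p.1.1 0 with hp | hp | hp
    · exact ⟨0, fun hp' => by omega, fun hp' => by omega⟩
    · refine ⟨s₀ p hp, fun _ => rfl, fun _ => ⟨hs₀' p hp, fun q hqp hq hq₀ => ?_⟩⟩
      have hq' : q.1.1 = 0 := le_antisymm (hp ▸ hqp.1) hq₀
      rw [(ih q hq).1 hq', hs₀ q p hq' hp hqp]
    by_cases hpz : p.1.2 = p.1.1 ∨ p.1.2 = p.1.1 + n + 1
    · exact ⟨0, fun hp' => by omega, fun _ => ⟨(hX.isZero p hpz).eq_of_src _ _,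
        fun q _ _ _ => (hW.isZero p hpz).eq_of_tgt _ _⟩⟩
    have hp₁ := p.2.1
    have hp₂ := p.2.2
    dsimp only [shift] at hp₂
    let o : Strip n := ⟨(p.1.1 - 1, p.1.2 - 1), by dsimp only [shift]; lia⟩
    let a : Strip n := ⟨(p.1.1 - 1, p.1.2), by dsimp only [shift]; lia⟩
    let b : Strip n := ⟨(p.1.1, p.1.2 - 1), by dsimp only [shift]; lia⟩
    have hoa : o ≤ a := ⟨le_rfl, show p.1.2 - 1 ≤ p.1.2 by omega⟩
    have hob : o ≤ b := ⟨show p.1.1 - 1 ≤ p.1.1 by omega, le_rfl⟩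
    have hap : a ≤ p := ⟨show p.1.1 - 1 ≤ p.1.1 by omega, le_rfl⟩
    have hbp : b ≤ p := ⟨le_rfl, show p.1.2 - 1 ≤ p.1.2 by omega⟩
    have ho₀ : 0 ≤ o.1.1 := show 0 ≤ p.1.1 - 1 by omega
    have ha₀ : 0 ≤ a.1.1 := ho₀
    have hb₀ : 0 ≤ b.1.1 := hp.le
    have hoa' : μ o < μ a := (hμ ho₀ hoa).resolve_left fun h => by
      have : p.1.2 - 1 = p.1.2 := congrArg (fun p : Strip n => p.1.2) h
      omega
    have hob' : μ o < μ b := (hμ ho₀ hob).resolve_left fun h => by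
      have : p.1.1 - 1 = p.1.1 := congrArg (fun p : Strip n => p.1.1) h
      omega
    have hap' : μ a < μ p := (hμ ha₀ hap).resolve_left fun h => by
      have : p.1.1 - 1 = p.1.1 := congrArg (fun p : Strip n => p.1.1) h
      omega
    have hbp' : μ b < μ p := (hμ hb₀ hbp).resolve_left fun h => by
      have : p.1.2 - 1 = p.1.2 := congrArg (fun p : Strip n => p.1.2) h
      omega
    have hsq := hX.exactSquare (p := o) (q := a) (p' := b) (q' := p) rfl rfl rfl rfl
      (show p.1.1 ≤ p.1.2 - 1 by omega) hoa hob hap hbp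
    obtain ⟨hga, hna⟩ := (ih a hap').2 ha₀
    obtain ⟨hgb, hnb⟩ := (ih b hbp').2 hb₀
    obtain ⟨v, hvb, hva⟩ := hsq.exists_desc (f b hbp' ≫ W.map (homOfLE hbp))
      (f a hap' ≫ W.map (homOfLE hap)) (by
        rw [← Category.assoc, ← Category.assoc, hna o hoa hoa' ho₀, hnb o hob hob' ho₀,
          Category.assoc, Category.assoc, ← W.map_comp, ← W.map_comp]
        rfl)
    obtain ⟨i, hi⟩ := hπ p
    have hra : X.map (homOfLE hap) ≫ (g.app p - v ≫ π.app p) = 0 := by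
      rw [Preadditive.comp_sub, ← Category.assoc, hva, g.naturality, Category.assoc,
        π.naturality, ← Category.assoc, hga, sub_self]
    have hrb : X.map (homOfLE hbp) ≫ (g.app p - v ≫ π.app p) = 0 := by
      rw [Preadditive.comp_sub, ← Category.assoc, hvb, g.naturality, Category.assoc,
        π.naturality, ← Category.assoc, hgb, sub_self]
    refine ⟨v + (g.app p - v ≫ π.app p) ≫ i, fun h => absurd h hp.ne', fun _ => ⟨?_, ?_⟩⟩
    · rw [Preadditive.add_comp, Category.assoc, hi, Category.comp_id, add_sub_cancel]
    · intro q hqp hq hq₀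
      -- every earlier point precedes one of the two direct predecessors
      obtain ⟨c, hqc, hcp, hc, hvc, hnc⟩ : ∃ (c : Strip n) (hqc : q ≤ c) (hcp : c ≤ p)
          (hc : μ c < μ p), X.map (homOfLE hcp) ≫ (v + (g.app p - v ≫ π.app p) ≫ i) =
            f c hc ≫ W.map (homOfLE hcp) ∧ ∀ (hq' : μ q < μ c),
            X.map (homOfLE hqc) ≫ f c hc = f q hq ≫ W.map (homOfLE hqc) := by
        by_cases h : q.1.1 < p.1.1
        · have hqa : q ≤ a := ⟨show q.1.1 ≤ p.1.1 - 1 by omega, hqp.2⟩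
          refine ⟨a, hqa, hap, hap', ?_, fun hq' => hna q hqa hq' hq₀⟩
          rw [Preadditive.comp_add, hva, ← Category.assoc, hra, zero_comp, add_zero]
        · have h₁ := hqp.1
          have hqb : q ≤ b := ⟨h₁, show q.1.2 ≤ p.1.2 - 1 by
            by_contra h'
            have h₂ := hqp.2
            have : q = p := Subtype.ext (Prod.ext (by omega) (by omega))
            exact absurd hq (this ▸ lt_irrefl _)⟩
          refine ⟨b, hqb, hbp, hbp', ?_, fun hq' => hnb q hqb hq' hq₀⟩
          rw [Preadditive.comp_add, hvb, ← Category.assoc, hrb, zero_comp, add_zero]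
      rcases hμ hq₀ hqc with rfl | hq'
      · exact hvc
      · have : homOfLE hqp = homOfLE hqc ≫ homOfLE hcp := rfl
        rw [this, X.map_comp, W.map_comp, Category.assoc, hvc, ← Category.assoc, hnc hq',
          Category.assoc]
  obtain ⟨s, hs⟩ := exists_of_measure (T := fun p => X.obj p ⟶ W.obj p) μ Q step
  refine ⟨s, fun p => (hs p).1, fun p hp => ((hs p).2 hp).1, fun p q hp hpq => ?_⟩
  rcases hμ hp hpq with rfl | h
  · have : homOfLE hpq = 𝟙 p := rfl
    rw [this, X.map_id, W.map_id, Category.id_comp, Category.comp_id]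
  · exact ((hs q).2 (hp.trans hpq.1)).2 p hpq h hp

/-- A morphism of pretriangles to `Y` can be lifted along a pointwise split epimorphism `W ⟶ Y`
of pretriangles as soon as it can be lifted in row zero. -/
theorem exists_lift {X W Y : Strip n ⥤ C} (hX : IsPretriangle C n X)
    (hW : IsPretriangle C n W) (hY : IsPretriangle C n Y) {π : W ⟶ Y}
    (hπ : ∀ p, ∃ i : Y.obj p ⟶ W.obj p, i ≫ π.app p = 𝟙 _) (g : X ⟶ Y)
    (s₀ : ∀ p : Strip n, p.1.1 = 0 → (X.obj p ⟶ W.obj p))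
    (hs₀ : ∀ (p q : Strip n) (hp : p.1.1 = 0) (hq : q.1.1 = 0) (h : p ≤ q),
      X.map (homOfLE h) ≫ s₀ q hq = s₀ p hp ≫ W.map (homOfLE h))
    (hs₀' : ∀ (p : Strip n) (hp : p.1.1 = 0), s₀ p hp ≫ π.app p = g.app p) :
    ∃ s : X ⟶ W, s ≫ π = g ∧ ∀ p hp, s.app p = s₀ p hp := by
  obtain ⟨u, hu₀, huπ, hu⟩ := exists_lift_nonneg hX hW hπ g s₀ hs₀ hs₀'
  -- The points in rows with negative number are treated in the opposite order; the coordinates of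
  -- such a point have a sum less than `n`, so the measure does not truncate there.
  let μ : Strip n → ℕ := fun p => (2 * n + 2 - p.1.1 - p.1.2).toNat
  have hμ : ∀ {p q : Strip n}, p.1.1 < 0 → p ≤ q → p = q ∨ μ q < μ p := by
    intro p q hp hpq
    by_cases h : p.1.1 = q.1.1 ∧ p.1.2 = q.1.2
    · exact Or.inl (Subtype.ext (Prod.ext h.1 h.2))
    · right
      have h₁ := hpq.1
      have h₂ := hpq.2
      have h₃ := p.2.2
      dsimp only [shift] at h₃
      change (2 * n + 2 - q.1.1 - q.1.2).toNat < (2 * n + 2 - p.1.1 - p.1.2).toNat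
      omega
  let Q : ∀ p, (∀ q, μ q < μ p → (X.obj q ⟶ W.obj q)) → (X.obj p ⟶ W.obj p) → Prop :=
    fun p f v => (0 ≤ p.1.1 → v = u p) ∧ (p.1.1 < 0 → v ≫ π.app p = g.app p ∧
      ∀ (q : Strip n) (hpq : p ≤ q) (hq : μ q < μ p),
        v ≫ W.map (homOfLE hpq) = X.map (homOfLE hpq) ≫ f q hq)
  have step : ∀ p f, (∀ q (hq : μ q < μ p), Q q (fun r hr => f r (hr.trans hq)) (f q hq)) →
      ∃ v, Q p f v := by
    intro p f ih
    rcases le_or_gt 0 p.1.1 with hp | hp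
    · exact ⟨u p, fun _ => rfl, fun hp' => by omega⟩
    by_cases hpz : p.1.2 = p.1.1 ∨ p.1.2 = p.1.1 + n + 1
    · exact ⟨0, fun hp' => by omega, fun _ => ⟨(hX.isZero p hpz).eq_of_src _ _,
        fun q _ _ => (hX.isZero p hpz).eq_of_src _ _⟩⟩
    have hp₁ := p.2.1
    have hp₂ := p.2.2
    dsimp only [shift] at hp₂
    let a : Strip n := ⟨(p.1.1, p.1.2 + 1), by dsimp only [shift]; lia⟩
    let b : Strip n := ⟨(p.1.1 + 1, p.1.2), by dsimp only [shift]; lia⟩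
    let o : Strip n := ⟨(p.1.1 + 1, p.1.2 + 1), by dsimp only [shift]; lia⟩
    have hao : a ≤ o := ⟨show p.1.1 ≤ p.1.1 + 1 by omega, le_rfl⟩
    have hbo : b ≤ o := ⟨le_rfl, show p.1.2 ≤ p.1.2 + 1 by omega⟩
    have hpa : p ≤ a := ⟨le_rfl, show p.1.2 ≤ p.1.2 + 1 by omega⟩
    have hpb : p ≤ b := ⟨show p.1.1 ≤ p.1.1 + 1 by omega, le_rfl⟩
    have hpa' : μ a < μ p := (hμ hp hpa).resolve_left fun h => by
      have : p.1.2 = p.1.2 + 1 := congrArg (fun p : Strip n => p.1.2) h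
      omega
    have hpb' : μ b < μ p := (hμ hp hpb).resolve_left fun h => by
      have : p.1.1 = p.1.1 + 1 := congrArg (fun p : Strip n => p.1.1) h
      omega
    have hf : ∀ (c : Strip n) (hc : μ c < μ p), f c hc ≫ π.app c = g.app c ∧
        ∀ (d : Strip n) (hcd : c ≤ d) (hd : μ d < μ p),
          f c hc ≫ W.map (homOfLE hcd) = X.map (homOfLE hcd) ≫ f d hd := by
      intro c hc
      by_cases hc₀ : 0 ≤ c.1.1
      · rw [(ih c hc).1 hc₀]
        refine ⟨huπ c hc₀, fun d hcd hd => ?_⟩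
        rw [(ih d hd).1 (hc₀.trans hcd.1)]
        exact (hu c d hc₀ hcd).symm
      · refine ⟨((ih c hc).2 (not_le.1 hc₀)).1, fun d hcd hd => ?_⟩
        rcases hμ (not_le.1 hc₀) hcd with rfl | h
        · have : homOfLE hcd = 𝟙 c := rfl
          rw [this, X.map_id, W.map_id, Category.id_comp, Category.comp_id]
        · exact ((ih c hc).2 (not_le.1 hc₀)).2 d hcd h
    have hpo' : μ o < μ p := (hμ hp (hpa.trans hao)).resolve_left fun h => by
      have : p.1.2 = p.1.2 + 1 := congrArg (fun p : Strip n => p.1.2) h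
      omega
    have hsq := hW.exactSquare (p := p) (q := a) (p' := b) (q' := o) rfl rfl rfl rfl
      (show p.1.1 + 1 ≤ p.1.2 by omega) hpa hpb hao hbo
    obtain ⟨v, hvb, hva⟩ := hsq.exists_lift (X.map (homOfLE hpb) ≫ f b hpb')
      (X.map (homOfLE hpa) ≫ f a hpa') (by
        rw [Category.assoc, Category.assoc, (hf a hpa').2 o hao hpo', (hf b hpb').2 o hbo hpo',
          ← Category.assoc, ← Category.assoc, ← X.map_comp, ← X.map_comp]
        rfl)
    -- correct the defect of `v` without changing the values in the direct successors
    obtain ⟨w, hw, hwa, hwb⟩ := exists_lift_of_comp_eq_zero hW hY hπ hpa hpb rfl rfl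
      (g.app p - v ≫ π.app p)
      (by rw [Preadditive.sub_comp, Category.assoc, ← π.naturality, reassoc_of% hva,
        (hf a hpa').1, g.naturality, sub_self])
      (by rw [Preadditive.sub_comp, Category.assoc, ← π.naturality, reassoc_of% hvb,
        (hf b hpb').1, g.naturality, sub_self])
    refine ⟨v + w, fun h => absurd h hp.not_ge, fun _ => ⟨?_, ?_⟩⟩
    · rw [Preadditive.add_comp, hw, add_sub_cancel]
    · intro q hpq hq
      -- every later point succeeds one of the two direct successors
      obtain ⟨c, hpc, hcq, hc, hvc⟩ : ∃ (c : Strip n) (hpc : p ≤ c) (_ : c ≤ q)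
          (hc : μ c < μ p), (v + w) ≫ W.map (homOfLE hpc) = X.map (homOfLE hpc) ≫ f c hc := by
        by_cases h : p.1.1 < q.1.1
        · refine ⟨b, hpb, ⟨show p.1.1 + 1 ≤ q.1.1 by omega, hpq.2⟩, hpb', ?_⟩
          rw [Preadditive.add_comp, hvb, hwb, add_zero]
        · have h₁ := hpq.1
          refine ⟨a, hpa, ⟨h₁, show p.1.2 + 1 ≤ q.1.2 from ?_⟩, hpa', ?_⟩
          · by_contra h'
            have h₂ := hpq.2
            have : p = q := Subtype.ext (Prod.ext (by omega) (by omega))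
            exact absurd hq (this ▸ lt_irrefl _)
          · rw [Preadditive.add_comp, hva, hwa, add_zero]
      have : homOfLE hpq = homOfLE hpc ≫ homOfLE hcq := rfl
      rw [this, X.map_comp, W.map_comp, ← Category.assoc, hvc, Category.assoc,
        (hf c hc).2 q hcq hq, Category.assoc]
  obtain ⟨s, hs⟩ := exists_of_measure (T := fun p => X.obj p ⟶ W.obj p) μ Q step
  refine ⟨{ app := s, naturality := fun p q h => ?_ }, ?_, fun p hp => ?_⟩
  · have hpq : p ≤ q := leOfHom h
    change X.map (homOfLE hpq) ≫ s q = s p ≫ W.map (homOfLE hpq)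
    by_cases hp : 0 ≤ p.1.1
    · rw [(hs p).1 hp, (hs q).1 (hp.trans hpq.1)]
      exact hu p q hp hpq
    · rcases hμ (not_le.1 hp) hpq with rfl | h
      · have : homOfLE hpq = 𝟙 p := rfl
        rw [this, X.map_id, W.map_id, Category.id_comp, Category.comp_id]
      · exact (((hs p).2 (not_le.1 hp)).2 q hpq h).symm
  · ext p
    change s p ≫ π.app p = g.app p
    by_cases hp : 0 ≤ p.1.1
    · rw [(hs p).1 hp]
      exact huπ p hp
    · exact ((hs p).2 (not_le.1 hp)).1
  · exact ((hs p).1 hp.ge).trans (hu₀ p hp)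

end Lifting

/-! ### Chains of regular morphisms are projective -/

section Chain

variable {C : Type u} [Category.{v} C] [Preadditive C]

/-- On the part of the chain that starts at `i`, there is a natural transformation to `W` that is a
section of `π` at `i`. The regularity of the morphisms that start at `i` yields idempotents `p m` of
`Z.obj i` with image the kernel of `Z.obj i ⟶ Z.obj (i + m)`. The identity is the sum of the
differences `p (m + 1) - p m`, and each of these factors over `Z.obj (i + m)` and vanishes in
`Z.obj (i + m + 1)`, hence can be lifted. -/
lemma exists_section_at {Z W : ℕ ⥤ C} (π : W ⟶ Z) (N : ℕ)
    (hN : ∀ k, N ≤ k → IsZero (Z.obj k))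
    (hreg : ∀ i j (h : i ≤ j), IsRegular (Z.map (homOfLE h)))
    (hker : ∀ i k (h : i ≤ k) (T : C) (v : T ⟶ Z.obj i), v ≫ Z.map (homOfLE h) = 0 →
      ∃ v' : T ⟶ W.obj i, v' ≫ π.app i = v ∧ v' ≫ W.map (homOfLE h) = 0) (i : ℕ) :
    ∃ ε : ∀ j, i ≤ j → (Z.obj j ⟶ W.obj j), ε i le_rfl ≫ π.app i = 𝟙 _ ∧
      ∀ j j' (h : i ≤ j) (h' : j ≤ j'),
        Z.map (homOfLE h') ≫ ε j' (h.trans h') = ε j h ≫ W.map (homOfLE h') := by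
  let z : ∀ m : ℕ, Z.obj i ⟶ Z.obj (i + m) := fun m => Z.map (homOfLE (Nat.le_add_right i m))
  have hz : ∀ m, z (m + 1) = z m ≫ Z.map (homOfLE (Nat.le_succ (i + m))) := fun m => by
    rw [← Z.map_comp]
    rfl
  choose s hs using fun m : ℕ => hreg i (i + m) (Nat.le_add_right i m)
  have hs : ∀ m, z m ≫ s m ≫ z m = z m := hs
  let p : ∀ m : ℕ, Z.obj i ⟶ Z.obj i := fun m => 𝟙 _ - z m ≫ s m
  have hp : ∀ m, p m ≫ z m = 0 := fun m => by
    rw [Preadditive.sub_comp, Category.id_comp, Category.assoc, hs, sub_self]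
  have hpp : ∀ m, p m ≫ p (m + 1) = p m := fun m => by
    change p m ≫ (𝟙 _ - z (m + 1) ≫ s (m + 1)) = p m
    rw [Preadditive.comp_sub, Category.comp_id, hz, ← Category.assoc, ← Category.assoc, hp,
      zero_comp, zero_comp, sub_zero]
  have hp₀ : p 0 = 0 := by
    have h : z 0 = 𝟙 _ := Z.map_id i
    have := hs 0
    rw [h, Category.id_comp] at this
    change 𝟙 _ - z 0 ≫ s 0 = 0
    rw [h, Category.id_comp, sub_eq_zero]
    exact (this.symm.trans (Category.comp_id _))
  have hpN : p N = 𝟙 _ := by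
    change 𝟙 _ - z N ≫ s N = _
    rw [(hN (i + N) (Nat.le_add_left N i)).eq_of_tgt (z N) 0, zero_comp, sub_zero]
  choose v hvπ hv using fun m : ℕ => hker i (i + (m + 1)) (Nat.le_add_right _ _) _
    (s m ≫ p (m + 1)) (by
      have := hp (m + 1)
      rw [Category.assoc]
      change s m ≫ p (m + 1) ≫ z (m + 1) = 0
      rw [this, comp_zero])
  refine ⟨fun j hj => ∑ m ∈ Finset.range N, if h : j ≤ i + m then
    Z.map (homOfLE h) ≫ v m ≫ W.map (homOfLE hj) else 0, ?_, fun j j' hj hj' => ?_⟩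
  · have hW : W.map (homOfLE (le_refl i)) = 𝟙 _ := W.map_id i
    rw [Preadditive.sum_comp]
    calc _ = ∑ m ∈ Finset.range N, (p (m + 1) - p m) := Finset.sum_congr rfl fun m _ => by
          rw [dif_pos (Nat.le_add_right i m), hW, Category.comp_id, Category.assoc, hvπ]
          have : z m ≫ s m = 𝟙 _ - p m := (sub_sub_cancel _ _).symm
          change z m ≫ s m ≫ p (m + 1) = _
          rw [← Category.assoc, this, Preadditive.sub_comp, Category.id_comp, hpp]
      _ = 𝟙 _ := by rw [Finset.sum_range_sub, hp₀, hpN, sub_zero]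
  · rw [Preadditive.comp_sum, Preadditive.sum_comp]
    refine Finset.sum_congr rfl fun m _ => ?_
    have hW : W.map (homOfLE (hj.trans hj')) = W.map (homOfLE hj) ≫ W.map (homOfLE hj') := by
      rw [← W.map_comp]
      rfl
    by_cases h : j' ≤ i + m
    · have hZ : Z.map (homOfLE (hj'.trans h)) = Z.map (homOfLE hj') ≫ Z.map (homOfLE h) := by
        rw [← Z.map_comp]
        rfl
      rw [dif_pos h, dif_pos (hj'.trans h), hW, hZ]
      simp only [Category.assoc]
    · rw [dif_neg h, comp_zero]
      by_cases h' : j ≤ i + m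
      · have hij : i + (m + 1) ≤ j' := by omega
        have : W.map (homOfLE (hj.trans hj')) =
            W.map (homOfLE (Nat.le_add_right i (m + 1))) ≫ W.map (homOfLE hij) := by
          rw [← W.map_comp]
          rfl
        rw [dif_pos h', Category.assoc, Category.assoc, ← hW, this, reassoc_of% (hv m), zero_comp,
          comp_zero]
      · rw [dif_neg h', zero_comp]

/-- A chain of regular morphisms is projective with respect to the transformations that are
surjective on kernels. -/
theorem exists_section_of_isRegular {Z W : ℕ ⥤ C} (π : W ⟶ Z) (N : ℕ)
    (hN : ∀ k, N ≤ k → IsZero (Z.obj k))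
    (hreg : ∀ i j (h : i ≤ j), IsRegular (Z.map (homOfLE h)))
    (hker : ∀ i k (h : i ≤ k) (T : C) (v : T ⟶ Z.obj i), v ≫ Z.map (homOfLE h) = 0 →
      ∃ v' : T ⟶ W.obj i, v' ≫ π.app i = v ∧ v' ≫ W.map (homOfLE h) = 0) :
    ∃ s : Z ⟶ W, s ≫ π = 𝟙 Z := by
  have key : ∀ i, ∃ s : Z ⟶ W, ∀ j < i, s.app j ≫ π.app j = 𝟙 _ := by
    intro i
    induction i with
    | zero => exact ⟨0, fun j hj => absurd hj (Nat.not_lt_zero j)⟩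
    | succ i ih =>
      obtain ⟨s, hs⟩ := ih
      obtain ⟨ε, hε, hε'⟩ := exists_section_at π N hN hreg hker i
      -- the defect of `s` vanishes below `i`, so composing with `ε` gives a transformation
      let r : Z ⟶ Z := 𝟙 Z - s ≫ π
      have hr : ∀ j, r.app j = 𝟙 _ - s.app j ≫ π.app j := fun j => by simp [r]
      have hr₀ : ∀ j < i, r.app j = 0 := fun j hj => by rw [hr, hs j hj, sub_self]
      let t : Z ⟶ W :=
        { app := fun j => if h : i ≤ j then r.app j ≫ ε j h else 0
          naturality := fun j j' a => by
            by_cases hj : i ≤ j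
            · have hj' := hj.trans (leOfHom a)
              rw [dif_pos hj, dif_pos hj', ← Category.assoc, r.naturality, Category.assoc,
                Category.assoc]
              exact congrArg (r.app j ≫ ·) (hε' j j' hj (leOfHom a))
            · rw [dif_neg hj, zero_comp]
              by_cases hj' : i ≤ j'
              · rw [dif_pos hj', ← Category.assoc, r.naturality, hr₀ j (not_le.1 hj), zero_comp,
                  zero_comp]
              · rw [dif_neg hj', comp_zero] }
      have ht : ∀ j, t.app j = if h : i ≤ j then r.app j ≫ ε j h else 0 := fun j => rfl
      refine ⟨s + t, fun j hj => ?_⟩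
      rw [NatTrans.app_add, Preadditive.add_comp, ht]
      rcases (Nat.lt_succ_iff.1 hj).lt_or_eq with h | rfl
      · rw [dif_neg (not_le.2 h), zero_comp, add_zero, hs j h]
      · rw [dif_pos le_rfl, Category.assoc, hε, Category.comp_id, hr, add_sub_cancel]
  obtain ⟨s, hs⟩ := key N
  refine ⟨s, ?_⟩
  ext j
  rcases lt_or_ge j N with h | h
  · exact hs j h
  · exact (hN j h).eq_of_src _ _

end Chain

/-! ### Restriction to the diagrams on `{1 < ⋯ < n}` -/

section Restriction

variable {C : Type u} [Category.{v} C] [Preadditive C] [HasBinaryBiproducts C] {n : ℕ}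

/-- The points of row zero of the strip, starting with the diagonal and constant from the upper
boundary on. -/
def rowZero (n : ℕ) : ℕ ⥤ Strip n :=
  Monotone.functor
    (f := fun k => (⟨(0, min k (n + 1)), by dsimp only [shift]; omega⟩ : Strip n))
    (fun _ _ h => ⟨le_rfl, show min (_ : ℤ) _ ≤ min _ _ by omega⟩)

lemma isRegular_map_of_row_zero {X : Pretriangle C n}
    (hX : ∀ ⦃i j : DotDelta n⦄ (a : i ⟶ j), IsRegular (((restriction C n).obj X).map a))
    {p q : Strip n} (hp : p.1.1 = 0) (hq : q.1.1 = 0) (h : p ≤ q) :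
    IsRegular (X.obj.map (homOfLE h)) := by
  obtain ⟨⟨a, i⟩, hp₁, hp₂⟩ := p
  obtain ⟨⟨b, j⟩, hq₁, hq₂⟩ := q
  dsimp only [shift] at hp hq hp₁ hp₂ hq₁ hq₂
  subst hp hq
  have hij : i ≤ j := h.2
  by_cases hi : i = 0
  · rw [(X.property.isZero _ (Or.inl hi)).eq_of_src (X.obj.map (homOfLE h)) 0]
    exact isRegular_zero _ _
  by_cases hj : j = n + 1
  · rw [(X.property.isZero _ (Or.inr (show j = 0 + n + 1 by omega))).eq_of_tgt
      (X.obj.map (homOfLE h)) 0]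
    exact isRegular_zero _ _
  · exact hX (i := ⟨i, by omega, by omega⟩) (j := ⟨j, by omega, by omega⟩) (homOfLE hij)

lemma eq_zero_of_restriction_map_eq_zero {X Y : Pretriangle C n} (g : X ⟶ Y)
    (hg : (restriction C n).map g = 0) (p : Strip n) (hp : p.1.1 = 0) : g.hom.app p = 0 := by
  obtain ⟨⟨a, i⟩, hp₁, hp₂⟩ := p
  dsimp only [shift] at hp hp₁ hp₂
  subst hp
  by_cases hi : i = 0
  · exact (X.property.isZero _ (Or.inl hi)).eq_of_src _ _
  by_cases hi' : i = n + 1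
  · exact (X.property.isZero _ (Or.inr (show i = 0 + n + 1 by omega))).eq_of_src _ _
  · exact congr_app hg (⟨i, by omega, by omega⟩ : DotDelta n)

variable [HasZeroObject C]

lemma hasFiniteBiproducts_of_binary : HasFiniteBiproducts C :=
  haveI : HasFiniteProducts C := hasFiniteProducts_of_has_binary_and_terminal
  HasFiniteBiproducts.of_hasFiniteProducts

attribute [local instance] hasFiniteBiproducts_of_binary

/-- The free pretriangle on the objects of the pretriangle `Y`. -/
abbrev freePretriangle (Y : Pretriangle C n) : Pretriangle C n :=
  ⟨freeDiagram Y.obj.obj, isPretriangle_freeDiagram _⟩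

lemma splitPretriangles_freePretriangle (Y : Pretriangle C n) :
    splitPretriangles C n (freePretriangle Y) :=
  (splitDiagrams_iff _).2 fun _ _ a => isRegular_freeDiagram_map _ a

/-- The morphism to `Y` from the free pretriangle on the objects of `Y`. -/
abbrev freePretriangleCounit (Y : Pretriangle C n) : freePretriangle Y ⟶ Y :=
  ObjectProperty.homMk (freeCounit Y.property.isZero)

open ZeroObject in
lemma isPretriangle_zero : IsPretriangle C n ((Functor.const (Strip n)).obj 0) where
  isZero_diag _ := isZero_zero C
  isZero_shift _ := isZero_zero C
  isWeakSquare _ _ _ _ _ _ _ _ := by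
    rw [isWeakSquare_iff_weakPullback]
    exact ⟨(isZero_zero C).eq_of_tgt _ _, fun T a b _ => ⟨0, (isZero_zero C).eq_of_tgt _ _,
      (isZero_zero C).eq_of_tgt _ _⟩⟩

variable [WeaklyAbelian C]

open ZeroObject in
variable (C n) in
instance : (restriction C n).Full where
  map_surjective {X Y} f := by
    classical
    let d : ∀ k : ℤ, IsDot n k → Strip n := fun k h => (dotInclusion n).obj ⟨k, h⟩
    let φ : ∀ k (h : IsDot n k), X.obj.obj (d k h) ⟶ Y.obj.obj (d k h) :=
      fun k h => f.app ⟨k, h⟩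
    have hd : ∀ (p : Strip n) h, p.1.1 = 0 → p ≤ d p.1.2 h := fun p h hp => ⟨hp.le, le_rfl⟩
    have hd' : ∀ (p : Strip n) h, p.1.1 = 0 → d p.1.2 h ≤ p := fun p h hp => ⟨hp.ge, le_rfl⟩
    obtain ⟨s, -, hs⟩ := exists_lift X.property Y.property isPretriangle_zero
      (π := (0 : Y.obj ⟶ (Functor.const (Strip n)).obj 0))
      (fun p => ⟨0, (isZero_zero C).eq_of_src _ _⟩) 0
      (fun p hp => if h : IsDot n p.1.2 then X.obj.map (homOfLE (hd p h hp)) ≫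
        φ p.1.2 h ≫ Y.obj.map (homOfLE (hd' p h hp)) else 0)
      (fun p q hp hq hpq => by
        have hp₁ := p.2.1
        have hq₂ := q.2.2
        have hpq₂ := hpq.2
        dsimp only [shift] at hq₂
        by_cases h : p.1.2 = p.1.1
        · exact (X.property.isZero p (Or.inl h)).eq_of_src _ _
        by_cases h' : q.1.2 = q.1.1 + n + 1
        · exact (Y.property.isZero q (Or.inr h')).eq_of_tgt _ _
        have hp' : IsDot n p.1.2 := ⟨by omega, by omega⟩
        have hq' : IsDot n q.1.2 := ⟨by omega, by omega⟩
        have hdd : d p.1.2 hp' ≤ d q.1.2 hq' := ⟨le_rfl, hpq₂⟩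
        have hn : X.obj.map (homOfLE hdd) ≫ φ q.1.2 hq' = φ p.1.2 hp' ≫ Y.obj.map (homOfLE hdd) :=
          f.naturality (X := ⟨p.1.2, hp'⟩) (Y := ⟨q.1.2, hq'⟩) (homOfLE hpq₂)
        rw [dif_pos hp', dif_pos hq', ← Category.assoc, ← X.obj.map_comp]
        have e₁ : homOfLE hpq ≫ homOfLE (hd q hq' hq) =
          homOfLE (hd p hp' hp) ≫ homOfLE hdd := rfl
        have e₂ : homOfLE hdd ≫ homOfLE (hd' q hq' hq) =
          homOfLE (hd' p hp' hp) ≫ homOfLE hpq := rfl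
        rw [e₁, X.obj.map_comp, Category.assoc, reassoc_of% hn, Category.assoc, Category.assoc,
          ← Y.obj.map_comp, e₂, Y.obj.map_comp])
      (fun p hp => (isZero_zero C).eq_of_tgt _ _)
    refine ⟨ObjectProperty.homMk s, ?_⟩
    ext i
    have h := hs (d i.1 i.2) rfl
    have hX : X.obj.map (homOfLE (hd (d i.1 i.2) i.2 rfl)) = 𝟙 _ := X.obj.map_id _
    have hY : Y.obj.map (homOfLE (hd' (d i.1 i.2) i.2 rfl)) = 𝟙 _ := Y.obj.map_id _
    exact h.trans ((dif_pos i.2).trans (by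
      rw [hX, hY]
      exact (Category.id_comp _).trans (Category.comp_id _)))

/-- A morphism of pretriangles that vanishes on `{1 < ⋯ < n}` factors over a free pretriangle. -/
lemma factorsOver_of_restriction_map_eq_zero {X Y : Pretriangle C n} (g : X ⟶ Y)
    (hg : (restriction C n).map g = 0) : FactorsOver (splitPretriangles C n) g := by
  obtain ⟨s, hs, -⟩ := exists_lift X.property (freePretriangle Y).property Y.property
    (exists_section_freeCounit Y.property.isZero) g.hom (fun _ _ => 0)
    (fun _ _ _ _ _ => by rw [comp_zero, zero_comp])
    (fun p hp => by rw [zero_comp, eq_zero_of_restriction_map_eq_zero g hg p hp])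
  exact ⟨freePretriangle Y, ObjectProperty.homMk s, freePretriangleCounit Y,
    splitPretriangles_freePretriangle Y, by ext1; exact hs⟩

/-- A pretriangle with split restriction is a direct summand of a free pretriangle. -/
lemma exists_section_freePretriangleCounit {Z : Pretriangle C n}
    (hZ : ∀ ⦃i j : DotDelta n⦄ (a : i ⟶ j), IsRegular (((restriction C n).obj Z).map a)) :
    ∃ s : Z ⟶ freePretriangle Z, s ≫ freePretriangleCounit Z = 𝟙 Z := by
  have hW := (freePretriangle Z).property
  have hπ := exists_section_freeCounit Z.property.isZero
  let R := (Functor.whiskeringLeft _ _ C).obj (rowZero n)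
  obtain ⟨s, hs⟩ := exists_section_of_isRegular (R.map (freePretriangleCounit Z).hom) (n + 1)
    (fun k hk => Z.property.isZero _ (Or.inr (show min (k : ℤ) (n + 1) = 0 + n + 1 by omega)))
    (fun i j h => isRegular_map_of_row_zero hZ rfl rfl _)
    (fun i k h T v hv => by
      let d : Strip n := ⟨(min (i : ℤ) (n + 1), min (i : ℤ) (n + 1)), by dsimp only [shift]; omega⟩
      have hd : (rowZero n).obj i ≤ d := ⟨show (0 : ℤ) ≤ min (i : ℤ) (n + 1) by omega, le_rfl⟩
      obtain ⟨v', h₁, h₂, -⟩ := exists_lift_of_comp_eq_zero hW Z.property hπ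
        (leOfHom ((rowZero n).map (homOfLE h))) hd rfl rfl v hv
        ((Z.property.isZero d (Or.inl rfl)).eq_of_tgt _ _)
      exact ⟨v', h₁, h₂⟩)
  let c : Strip n → Strip n := fun p => (rowZero n).obj p.1.2.toNat
  have hc : ∀ p : Strip n, p.1.1 = 0 → p ≤ c p := fun p hp => ⟨hp.le, by
    have h₁ := p.2.1
    have h₂ := p.2.2
    dsimp only [shift] at h₂
    change p.1.2 ≤ min (p.1.2.toNat : ℤ) (n + 1)
    omega⟩
  have hc' : ∀ p : Strip n, p.1.1 = 0 → c p ≤ p := fun p hp => ⟨hp.ge, by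
    have h₁ := p.2.1
    change min (p.1.2.toNat : ℤ) (n + 1) ≤ p.1.2
    omega⟩
  have hs' : ∀ k, s.app k ≫ (freeCounit Z.property.isZero).app ((rowZero n).obj k) = 𝟙 _ :=
    fun k => congr_app hs k
  obtain ⟨t, ht, -⟩ := exists_lift Z.property hW Z.property hπ (𝟙 Z.obj)
    (fun p hp => Z.obj.map (homOfLE (hc p hp)) ≫ s.app p.1.2.toNat ≫
      (freeDiagram Z.obj.obj).map (homOfLE (hc' p hp)))
    (fun p q hp hq hpq => by
      have hpq' : p.1.2.toNat ≤ q.1.2.toNat := Int.toNat_le_toNat hpq.2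
      have hn : Z.obj.map ((rowZero n).map (homOfLE hpq')) ≫ s.app q.1.2.toNat =
        s.app p.1.2.toNat ≫ (freeDiagram Z.obj.obj).map ((rowZero n).map (homOfLE hpq')) :=
        s.naturality (homOfLE hpq')
      have e₁ : homOfLE hpq ≫ homOfLE (hc q hq) =
        homOfLE (hc p hp) ≫ (rowZero n).map (homOfLE hpq') := rfl
      have e₂ : (rowZero n).map (homOfLE hpq') ≫ homOfLE (hc' q hq) =
        homOfLE (hc' p hp) ≫ homOfLE hpq := rfl
      rw [← Category.assoc, ← Z.obj.map_comp, e₁, Z.obj.map_comp, Category.assoc,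
        reassoc_of% hn, Category.assoc, Category.assoc, ← Functor.map_comp, e₂,
        Functor.map_comp])
    (fun p hp => by
      rw [Category.assoc, Category.assoc, NatTrans.naturality, reassoc_of% (hs' p.1.2.toNat),
        ← Z.obj.map_comp]
      exact Z.obj.map_id p)
  exact ⟨ObjectProperty.homMk t, by ext1; exact ht⟩

end Restriction

/-! ### The equivalence -/

section Stable

variable (C : Type u) [Category.{v} C] [Preadditive C] [HasZeroObject C] [HasBinaryBiproducts C]
  [WeaklyAbelian C] (n : ℕ)

variable {C n} in
/-- Two morphisms of pretriangles whose restrictions differ by a morphism that factors over a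
split diagram agree stably. -/
lemma modFunctor_map_eq_of_modRel {X Y : Pretriangle C n} (f g : X ⟶ Y)
    (h : modRel (splitDiagrams (DotDelta n) C) ((restriction C n).map f)
      ((restriction C n).map g)) :
    (modFunctor (splitPretriangles C n)).map f = (modFunctor (splitPretriangles C n)).map g := by
  obtain ⟨Z, a, b, hZ, hab⟩ := h
  let Z' := (restriction C n).objPreimage Z
  let e : (restriction C n).obj Z' ≅ Z := (restriction C n).objObjPreimageIso Z
  obtain ⟨a', ha'⟩ := (restriction C n).map_surjective (a ≫ e.inv)
  obtain ⟨b', hb'⟩ := (restriction C n).map_surjective (e.hom ≫ b)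
  have hZ' : ∀ ⦃i j : DotDelta n⦄ (t : i ⟶ j), IsRegular (((restriction C n).obj Z').map t) :=
    fun i j t => ((splitDiagrams_iff Z).1 hZ t).of_arrow_iso
      (Arrow.isoMk (e.app i) (e.app j) (e.hom.naturality t).symm)
  obtain ⟨s, hs⟩ := exists_section_freePretriangleCounit hZ'
  have h₁ : modRel (splitPretriangles C n) f (f - a' ≫ b') := by
    refine ⟨freePretriangle Z', a' ≫ s, freePretriangleCounit Z' ≫ b',
      splitPretriangles_freePretriangle Z', ?_⟩
    rw [Category.assoc, reassoc_of% hs, sub_sub_cancel]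
  have h₂ : modRel (splitPretriangles C n) (f - a' ≫ b') g := by
    refine factorsOver_of_restriction_map_eq_zero _ ?_
    have : (restriction C n).map (a' ≫ b') =
        (restriction C n).map f - (restriction C n).map g := by
      rw [Functor.map_comp, ha', hb', ← hab]
      simp
    have h : (restriction C n).map (f - a' ≫ b' - g) = (restriction C n).map f -
      (restriction C n).map (a' ≫ b') - (restriction C n).map g := rfl
    rw [h, this, sub_sub_cancel, sub_self]
  exact (CategoryTheory.Quotient.sound _ h₁).trans (CategoryTheory.Quotient.sound _ h₂)

variable {C n} in
/-- Since the restriction functor is full, a chain of relations between restrictions can be lifted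
link by link. -/
lemma modFunctor_map_eq_of_eqvGen {X Y : Pretriangle C n}
    {a b : (restriction C n).obj X ⟶ (restriction C n).obj Y}
    (h : Relation.EqvGen (@HomRel.CompClosure _ _ (modRel (splitDiagrams (DotDelta n) C)) _ _)
      a b) :
    ∀ f g : X ⟶ Y, (restriction C n).map f = a → (restriction C n).map g = b →
      (modFunctor (splitPretriangles C n)).map f =
        (modFunctor (splitPretriangles C n)).map g := by
  induction h with
  | rel a b h =>
    rintro f g hf hg
    refine modFunctor_map_eq_of_modRel f g ?_
    rw [hf, hg]
    obtain ⟨c, d, k, m₁, m₂, l, ⟨Z, p, q, hZ, hpq⟩⟩ := h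
    refine ⟨Z, k ≫ p, q ≫ l, hZ, ?_⟩
    rw [Category.assoc, reassoc_of% hpq, ← Preadditive.comp_sub, ← Preadditive.sub_comp]
  | refl a =>
    rintro f g hf hg
    refine CategoryTheory.Quotient.sound _ (factorsOver_of_restriction_map_eq_zero _ ?_)
    have h : (restriction C n).map (f - g) =
      (restriction C n).map f - (restriction C n).map g := rfl
    rw [h, hf, hg, sub_self]
  | symm a b _ ih => exact fun f g hf hg => (ih g f hg hf).symm
  | trans a b c _ _ ih₁ ih₂ =>
    intro f g hf hg
    obtain ⟨k, hk⟩ := (restriction C n).map_surjective b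
    exact (ih₁ f k hf hk).trans (ih₂ k g hk hg)

instance : (stableRestriction C n).Faithful where
  map_injective {X Y f g} h := by
    obtain ⟨X⟩ := X
    obtain ⟨Y⟩ := Y
    obtain ⟨f, rfl⟩ := (modFunctor (splitPretriangles C n)).map_surjective f
    obtain ⟨g, rfl⟩ := (modFunctor (splitPretriangles C n)).map_surjective g
    exact modFunctor_map_eq_of_eqvGen
      ((CategoryTheory.Quotient.functor_homRel_eq_compClosure_eqvGen _ _ _).1 h) f g rfl rfl

instance : (stableRestriction C n).Full where
  map_surjective {X Y} f := by
    obtain ⟨X⟩ := X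
    obtain ⟨Y⟩ := Y
    obtain ⟨f, rfl⟩ := (modFunctor (splitDiagrams (DotDelta n) C)).map_surjective
      (X := (restriction C n).obj X) (Y := (restriction C n).obj Y) f
    obtain ⟨f, rfl⟩ := (restriction C n).map_surjective f
    exact ⟨(modFunctor (splitPretriangles C n)).map f, rfl⟩

instance : (stableRestriction C n).EssSurj where
  mem_essImage X := by
    obtain ⟨X⟩ := X
    exact ⟨(modFunctor (splitPretriangles C n)).obj ((restriction C n).objPreimage X),
      ⟨(modFunctor (splitDiagrams (DotDelta n) C)).mapIso
        ((restriction C n).objObjPreimageIso X)⟩⟩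

end Stable

end Heller

end

theorem mainTheorem4 {C : Type u} [Category.{v} C] [Preadditive C] [HasZeroObject C]
    [HasBinaryBiproducts C] [Heller.WeaklyAbelian C] (n : ℕ) :
    (Heller.stableRestriction C n).IsEquivalence := {}
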